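/- **Conventions.** Let $\Gamma$ be a finite connected simple graph with at least two vertices and let $n\ge 0$. A graph is *sufficiently subdivided for $n$* if it has at least $n$ vertices, each path between two distinct vertices of valency $\neq 2$ has at least $n-1$ edges, and each simple loop has at least $n+1$ edges. A graph *contains* another graph $\Gamma'$ if a subdivision of $\Gamma'$ is a subgraph of a subdivision of it. $S_0$ is the graph consisting of a circle with two pendant edges attached at two different points of the circle. The $i$-cells of the cubical complex $UD_n\Gamma$ are the sets $c=\{\sigma_1,\dots,\sigma_n\}$ of $n$ vertices and edges of $\Gamma$, exactly $i$ of them edges, whose closures are pairwise disjoint. Let $C_i$ be the free abelian group on the $i$-cells. *Choices.* Choose a maximal tree $T$ of $\Gamma$, itself sufficiently subdivided for $n$, a planar embedding of $T$ and a base vertex of valency $1$ in $T$, and number the vertices $0,1,2,\dots$ in the order in which they are first met when one travels clockwise, from the base vertex $0$, along the boundary of a regular neighbourhood of $T$. For an edge $e$ let $\iota(e)$ and $\tau(e)$ be its larger and its smaller end vertex. With the edges $e_1,\dots,e_i$ of $c$ ordered by $\iota(e_1)<\dots<\iota(e_i)$, put $\partial c=\sum_{k=1}^i(-1)^k(\partial^\iota_kc-\partial^\tau_kc)$,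 where $\partial_k^\iota$ and $\partial^\tau_k$ replace $e_k$ by $\iota(e_k)$ and $\tau(e_k)$. *Morse complex.* A vertex $v\ne0$ of a cell $c$ is unblocked if, for the edge $e$ of $T$ with $\iota(e)=v$, the vertex $\tau(e)$ is neither a vertex of $c$ nor an end of an edge of $c$; the vertex $0$ is never unblocked. By induction on $i$, for an $i$-cell $c$ let $W(c)$ be the $(i+1)$-cell obtained by replacing the smallest unblocked vertex $v$ of $c$ by the edge $e$ of $T$ with $\iota(e)=v$, if $c$ has an unblocked vertex and is not a value of $W$ on an $(i-1)$-cell; otherwise $W(c)$ is void. A cell $c$ is redundant if $W(c)$ is not void, collapsible if it is a value of $W$, and critical if it is neither. Let $R:C_i\to C_i$ be the homomorphism with $R(c)=0$ for $c$ collapsible, $R(c)=c$ for $c$ critical, and $R(c)=\pm\partial W(c)+c$ for $c$ redundant, the sign making the coefficient of $c$ in $\pm\partial W(c)$ equal to $-1$. Let $\widetilde R=R^m$, where $m$ is the least number such that $R^m=R^{m+1}$. Let $M_i(UD_n\Gamma)\subset C_i$ be the free abelian group on the critical $i$-cells and $\widetilde\partial=\widetilde R\,\partial:M_i(UD_n\Gamma)\to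 M_{i-1}(UD_n\Gamma)$. **Theorem.** Suppose that $\Gamma$ is sufficiently subdivided for $n$ and does not contain $S_0$. Then the choices above can be made so that the following holds. In every degree the powers of $R$ stabilize and $\widetilde R$ takes its values in $M_i(UD_n\Gamma)$; all boundary maps of the Morse complex $(M_*(UD_n\Gamma),\widetilde\partial)$ are zero; and hence, for every $i$, $H_i(M_*(UD_n\Gamma))$ is the free abelian group over the critical $i$-cells (each critical cell is a cycle, and the classes of the critical $i$-cells form a basis). -/

import Mathlib

open CategoryTheory

noncomputable section

namespace GraphBraid

universe u

/-! ### Graphs: subdivision, containment, the graph `S₀` -/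

/-- `H` is a subdivision of `G`: every edge `uv` of `G` is replaced by a path of `H` from (the copy
of) `u` to (the copy of) `v`, the interiors of these paths being pairwise disjoint and free of
original vertices, and `H` is the union of the original vertices and of these paths. -/
structure Subdivision {V W : Type*} (G : SimpleGraph V) (H : SimpleGraph W) where
  vert : V ↪ W
  path : ∀ {a b : V}, G.Adj a b → H.Walk (vert a) (vert b)
  isPath : ∀ {a b : V} (h : G.Adj a b), (path h).IsPath
  path_symm : ∀ {a b : V} (h : G.Adj a b), path h.symm = (path h).reverse
  vert_mem : ∀ {a b : V} (h : G.Adj a b) (v : V), vert v ∈ (path h).support → v = a ∨ v = b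
  disjoint : ∀ {a b a' b' : V} (h : G.Adj a b) (h' : G.Adj a' b') (x : W),
    x ∈ (path h).support → x ∈ (path h').support → s(a, b) = s(a', b') ∨ x ∈ Set.range vert
  cover_vert : ∀ x : W, x ∈ Set.range vert ∨
    ∃ (a b : V) (h : G.Adj a b), x ∈ (path h).support
  cover_edge : ∀ e ∈ H.edgeSet, ∃ (a b : V) (h : G.Adj a b), e ∈ (path h).edges

/-- `G` contains `G'`: a subdivision of `G'` is a subgraph of a subdivision of `G`
(all graphs are finite). -/
def Contains {V V' : Type*} (G : SimpleGraph V) (G' : SimpleGraph V') : Prop :=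
  ∃ (m m' : ℕ) (H : SimpleGraph (Fin m)) (H' : SimpleGraph (Fin m')),
    Nonempty (Subdivision G H) ∧ Nonempty (Subdivision G' H') ∧ H'.IsContained H

/-- The graph `S₀`: a circle (here the triangle `1, 2, 3`) with two pendant edges attached at two
different points of the circle (here the edges `0-1` and `3-4`). -/
def S₀ : SimpleGraph (Fin 5) :=
  SimpleGraph.fromEdgeSet {s(0, 1), s(1, 2), s(1, 3), s(2, 3), s(3, 4)}

/-- The valency of a vertex. -/
def valency {V : Type*} (G : SimpleGraph V) (v : V) : ℕ := (G.neighborSet v).ncard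

/-- `G` is sufficiently subdivided for `n` points: it has at least `n` vertices, each path between
two different vertices of valency `≠ 2` has at least `n - 1` edges, and each simple loop has at
least `n + 1` edges. -/
structure SufficientlySubdivided {V : Type*} [Fintype V] (n : ℕ) (G : SimpleGraph V) : Prop where
  card_le : n ≤ Fintype.card V
  path_length : ∀ (a b : V) (p : G.Walk a b), p.IsPath → a ≠ b → valency G a ≠ 2 →
    valency G b ≠ 2 → n ≤ p.length + 1
  cycle_length : ∀ (a : V) (p : G.Walk a a), p.IsCycle → n + 1 ≤ p.length

/-! ### Maximal trees and the order of the vertices given by a planar embedding -/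

/-- A planar embedding of a tree `T` is recorded by the clockwise cyclic order `rot v` of the
neighbours of each vertex `v`. Travelling along the boundary of a regular neighbourhood of `T`,
after running along the oriented edge `(a, b)` one turns at `b` into the edge next to `(b, a)`. -/
def boundaryStep {V : Type*} {T : SimpleGraph V}
    (rot : ∀ v : V, Equiv.Perm (T.neighborSet v)) (d : T.Dart) : T.Dart :=
  ⟨(d.snd, (rot d.snd ⟨d.fst, d.adj.symm⟩ : T.neighborSet d.snd)),
    (rot d.snd ⟨d.fst, d.adj.symm⟩).2⟩

/-- The time at which the boundary tour that begins with the oriented edge `start` first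
meets `v`. -/
def firstVisit {V : Type*} {T : SimpleGraph V}
    (rot : ∀ v : V, Equiv.Perm (T.neighborSet v)) (start : T.Dart) (v : V) : ℕ :=
  sInf {k : ℕ | ((boundaryStep rot)^[k] start).fst = v}

/-- The choices on which the Morse complex of `UDₙΓ` depends: a (sufficiently subdivided) maximal
tree `T` of `Γ`, a planar embedding of `T`, a base vertex of valency 1 in `T` (the first vertex of
`start`; `start` is then determined by it), and the resulting numbering of the vertices in the
order in which they are met on the boundary tour from the base vertex. -/
structure OrderedTree {V : Type u} [Fintype V] (Γ : SimpleGraph V) (n : ℕ) where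
  T : SimpleGraph V
  le : T ≤ Γ
  isTree : T.IsTree
  subdivided : SufficientlySubdivided n T
  rot : ∀ v : V, Equiv.Perm (T.neighborSet v)
  rot_cyclic : ∀ (v : V) (a b : T.neighborSet v), (rot v).SameCycle a b
  start : T.Dart
  valency_start : valency T start.fst = 1
  num : V ≃ Fin (Fintype.card V)
  num_lt_iff : ∀ v w : V, num v < num w ↔ firstVisit rot start v < firstVisit rot start w

/-! ### Cells of the unordered discrete configuration space -/

/-- An `i`-cell `{σ₁, …, σₙ}` of `UDₙΓ`: a set of `n` vertices and edges of `Γ`, of which `i` are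
edges, with pairwise disjoint closures. -/
@[ext] structure Cell {V : Type u} (Γ : SimpleGraph V) (n i : ℕ) where
  verts : Finset V
  edges : Finset (Sym2 V)
  edges_subset : ∀ e ∈ edges, e ∈ Γ.edgeSet
  disjoint_edges : ∀ e ∈ edges, ∀ e' ∈ edges, ∀ v : V, v ∈ e → v ∈ e' → e = e'
  disjoint_verts : ∀ v ∈ verts, ∀ e ∈ edges, v ∉ e
  card_edges : edges.card = i
  card_total : verts.card + edges.card = n

namespace Cell

variable {V : Type u} {Γ : SimpleGraph V} {n i : ℕ}

/-- `v` appears in `c`, as a vertex or as an end vertex of an edge. -/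
def Occupied (c : Cell Γ n i) (v : V) : Prop := v ∈ c.verts ∨ ∃ e ∈ c.edges, v ∈ e

variable [DecidableEq V]

/-- Replace a vertex `v` of `c` by an edge `wv` whose other end `w` does not appear in `c`. -/
def slide (c : Cell Γ n i) (w v : V) (hv : v ∈ c.verts) (h : Γ.Adj w v) (hw : ¬ c.Occupied w) :
    Cell Γ n (i + 1) where
  verts := c.verts.erase v
  edges := insert s(w, v) c.edges
  edges_subset := by
    intro e he
    rcases Finset.mem_insert.1 he with rfl | he
    · exact h
    · exact c.edges_subset e he
  disjoint_edges := by
    have key : ∀ e ∈ c.edges, ∀ x, x ∈ s(w, v) → x ∈ e → False := by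
      intro e he x hx hxe
      rcases Sym2.mem_iff.1 hx with rfl | rfl
      · exact hw (Or.inr ⟨e, he, hxe⟩)
      · exact c.disjoint_verts _ hv e he hxe
    intro e he e' he' x hx hx'
    rcases Finset.mem_insert.1 he with rfl | he <;> rcases Finset.mem_insert.1 he' with rfl | he'
    · rfl
    · exact (key e' he' x hx hx').elim
    · exact (key e he x hx' hx).elim
    · exact c.disjoint_edges e he e' he' x hx hx'
  disjoint_verts := by
    intro x hx e he hxe
    rw [Finset.mem_erase] at hx
    rcases Finset.mem_insert.1 he with rfl | he
    · rcases Sym2.mem_iff.1 hxe with rfl | rfl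
      · exact hw (Or.inl hx.2)
      · exact hx.1 rfl
    · exact c.disjoint_verts x hx.2 e he hxe
  card_edges := by
    rw [Finset.card_insert_of_notMem, c.card_edges]
    exact fun he => hw (Or.inr ⟨_, he, Sym2.mem_mk_left w v⟩)
  card_total := by
    have h1 : s(w, v) ∉ c.edges := fun he => hw (Or.inr ⟨_, he, Sym2.mem_mk_left w v⟩)
    rw [Finset.card_insert_of_notMem h1, Finset.card_erase_of_mem hv]
    have h2 := c.card_total
    have h3 : 0 < c.verts.card := Finset.card_pos.2 ⟨v, hv⟩
    omega

/-- The face of `c` in which the edge `e` is replaced by its end vertex `x`. -/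
def face (c : Cell Γ n (i + 1)) (e : Sym2 V) (he : e ∈ c.edges) (x : V) (hx : x ∈ e) :
    Cell Γ n i where
  verts := insert x c.verts
  edges := c.edges.erase e
  edges_subset := fun e' he' => c.edges_subset e' (Finset.mem_of_mem_erase he')
  disjoint_edges := fun e' he' e'' he'' =>
    c.disjoint_edges e' (Finset.mem_of_mem_erase he') e'' (Finset.mem_of_mem_erase he'')
  disjoint_verts := by
    intro y hy e' he' hye'
    rw [Finset.mem_erase] at he'
    rcases Finset.mem_insert.1 hy with rfl | hy
    · exact he'.1 (c.disjoint_edges e' he'.2 e he y hye' hx)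
    · exact c.disjoint_verts y hy e' he'.2 hye'
  card_edges := by
    rw [Finset.card_erase_of_mem he, c.card_edges]
    rfl
  card_total := by
    have h1 : x ∉ c.verts := fun h => c.disjoint_verts x h e he hx
    rw [Finset.card_insert_of_notMem h1, Finset.card_erase_of_mem he, c.card_edges]
    have h2 := c.card_total
    rw [c.card_edges] at h2
    omega

end Cell

/-! ### The Morse complex -/

namespace OrderedTree

variable {V : Type u} [Fintype V] {Γ : SimpleGraph V} {n : ℕ} (D : OrderedTree Γ n)

/-- The initial vertex `ι(e)` of an edge: the larger end vertex. -/
def init (e : Sym2 V) : V := D.num.symm (e.map D.num).sup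

/-- The terminal vertex `τ(e)` of an edge: the smaller end vertex. -/
def term (e : Sym2 V) : V := D.num.symm (e.map D.num).inf

theorem init_mem (e : Sym2 V) : D.init e ∈ e := by
  induction e with | _ a b
  rcases le_total (D.num a) (D.num b) with h | h <;> simp [init, h]

theorem term_mem (e : Sym2 V) : D.term e ∈ e := by
  induction e with | _ a b
  rcases le_total (D.num a) (D.num b) with h | h <;> simp [term, h]

variable {i : ℕ}

/-- `v` is an unblocked vertex of `c`, witnessed by the end `w` of the edge `w-v` of the tree with
initial vertex `v`: the smaller vertex `w` does not appear in `c`. -/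
def UnblockedVia (c : Cell Γ n i) (w v : V) : Prop :=
  v ∈ c.verts ∧ D.T.Adj w v ∧ D.num w < D.num v ∧ ¬ c.Occupied w

/-- `v` is the smallest unblocked vertex of `c`, and `w-v` is the edge of the tree with initial
vertex `v`. -/
def SmallestUnblocked (c : Cell Γ n i) (w v : V) : Prop :=
  D.UnblockedVia c w v ∧ ∀ w' v' : V, D.UnblockedVia c w' v' → D.num v ≤ D.num v'

variable [DecidableEq V]

open Classical in
/-- Replace the smallest unblocked vertex `v` of `c` by the edge `w-v`; `none` stands for void. -/
def push (c : Cell Γ n i) : Option (Cell Γ n (i + 1)) :=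
  if h : ∃ p : V × V, D.SmallestUnblocked c p.1 p.2 then
    some (c.slide h.choose.1 h.choose.2 h.choose_spec.1.1 (D.le h.choose_spec.1.2.1)
      h.choose_spec.1.2.2.2)
  else none

open Classical in
/-- The function `W : Kᵢ → Kᵢ₊₁ ∪ {void}`, by induction on `i`. -/
def W : (i : ℕ) → Cell Γ n i → Option (Cell Γ n (i + 1))
  | 0, c => D.push c
  | i + 1, c => if ∃ b : Cell Γ n i, W i b = some c then none else D.push c

/-- `c` is redundant: it is moved by `W`. -/
def Redundant (c : Cell Γ n i) : Prop := D.W i c ≠ none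

/-- `c` is collapsible: it is a value of `W`. -/
def Collapsible : {i : ℕ} → Cell Γ n i → Prop
  | 0, _ => False
  | i + 1, c => ∃ b : Cell Γ n i, D.W i b = some c

/-- `c` is critical: it is neither redundant nor collapsible. -/
def Critical (c : Cell Γ n i) : Prop := ¬ D.Redundant c ∧ ¬ D.Collapsible c

/-- The cubical boundary `∂c = ∑ₖ (-1)ᵏ (∂ₖ^ι c - ∂ₖ^τ c)` of a cell, the edges `e₁, e₂, …` of `c`
being ordered by their initial vertices. -/
def cellBoundary (c : Cell Γ n (i + 1)) : Cell Γ n i →₀ ℤ :=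
  ∑ e ∈ c.edges.attach,
    (-1 : ℤ) ^ (c.edges.filter fun e' => D.num (D.init e') ≤ D.num (D.init e.1)).card •
      (Finsupp.single (c.face e.1 e.2 (D.init e.1) (D.init_mem e.1)) 1 -
        Finsupp.single (c.face e.1 e.2 (D.term e.1) (D.term_mem e.1)) 1)

/-- The boundary map `∂ : Cᵢ₊₁(UDₙΓ) → Cᵢ(UDₙΓ)` of the cubical chain complex; `Cᵢ(UDₙΓ)` is the
free abelian group on the `i`-cells. -/
def boundary (i : ℕ) : (Cell Γ n (i + 1) →₀ ℤ) →ₗ[ℤ] (Cell Γ n i →₀ ℤ) :=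
  Finsupp.linearCombination ℤ D.cellBoundary

open Classical in
/-- `R(c)`: it is `0` for collapsible `c`, `c` for critical `c`, and `±∂W(c) + c` for redundant `c`,
with the sign `- (coefficient of c in ∂W(c))` that makes the coefficient of `c` in
`±∂W(c)` equal to `-1`. -/
def cellRewrite (c : Cell Γ n i) : Cell Γ n i →₀ ℤ :=
  if D.Collapsible c then 0
  else match D.W i c with
    | some b => -(D.cellBoundary b c) • D.cellBoundary b + Finsupp.single c 1
    | none => Finsupp.single c 1

/-- The rewriting homomorphism `R : Cᵢ(UDₙΓ) → Cᵢ(UDₙΓ)`. -/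
def rewrite (i : ℕ) : Module.End ℤ (Cell Γ n i →₀ ℤ) :=
  Finsupp.linearCombination ℤ D.cellRewrite

/-- The stable power `Rᵐ`, where `m` is the least number with `Rᵐ = Rᵐ⁺¹`. -/
def stableRewrite (i : ℕ) : Module.End ℤ (Cell Γ n i →₀ ℤ) :=
  D.rewrite i ^ sInf {m : ℕ | D.rewrite i ^ m = D.rewrite i ^ (m + 1)}

/-- The stable rewriting maps are well defined: the powers of `R` stabilize, and the stable power
takes its values in the span of the critical cells. -/
def RewritingStabilizes : Prop :=
  ∀ i : ℕ, (∃ m : ℕ, D.rewrite i ^ m = D.rewrite i ^ (m + 1)) ∧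
    ∀ x : Cell Γ n i →₀ ℤ, ∀ c ∈ (D.stableRewrite i x).support, D.Critical c

/-- `Mᵢ(UDₙΓ)`: the free abelian group on the critical `i`-cells. -/
abbrev MorseChains (i : ℕ) : Type u := {c : Cell Γ n i // D.Critical c} →₀ ℤ

/-- The map `R̃ : Cᵢ(UDₙΓ) → Mᵢ(UDₙΓ)`: the stable power of `R`, read in the coordinates given by
the critical cells. -/
def toMorse (i : ℕ) : (Cell Γ n i →₀ ℤ) →ₗ[ℤ] D.MorseChains i :=
  (Finsupp.lcomapDomain Subtype.val Subtype.val_injective).comp (D.stableRewrite i)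

/-- The boundary map `∂̃ = R̃ ∂ : Mᵢ₊₁(UDₙΓ) → Mᵢ(UDₙΓ)` of the Morse complex. -/
def morseBoundary (i : ℕ) : D.MorseChains (i + 1) →ₗ[ℤ] D.MorseChains i :=
  (D.toMorse i).comp ((D.boundary i).comp (Finsupp.lmapDomain ℤ ℤ Subtype.val))

/-- The Morse complex `(M_*(UDₙΓ), ∂̃)`, once `∂̃ ∂̃ = 0` is known. -/
def morseComplex (h : ∀ i : ℕ, (D.morseBoundary i).comp (D.morseBoundary (i + 1)) = 0) :
    ChainComplex (ModuleCat.{u} ℤ) ℕ :=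
  ChainComplex.of (fun i => ModuleCat.of ℤ (D.MorseChains i))
    (fun i => ModuleCat.ofHom (D.morseBoundary i))
    (fun i => by rw [← ModuleCat.ofHom_comp, h i, ModuleCat.ofHom_zero])

end OrderedTree

end GraphBraid

end

/-!
The boundary maps of the Morse complex vanish because the critical cells are separated by cocycles.

Let `E` be the set of edges of a critical `i`-cell `c`. The *type* of an `i`-cell with edge set `E`
is the number of its vertices in each component of the tree `T` minus the closed edges in `E`. The
cochain `typeCochain c` with value 1 on the cells of the type of `c` and 0 elsewhere is a cocycle:
if an `(i + 1)`-cell consists of `E`, a further edge `f` and some vertices, then `f` is disjoint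
from the edges in `E`, so that its two ends lie in the same component and the two faces at `f` have
the same type (`Critical.sameType_face`). This cocycle vanishes on collapsible cells
(`Critical.not_collapsible_of_sameType`), and `c` is the only critical cell on which it does not
vanish (`Critical.eq_of_sameType`): `T` is so finely subdivided that the vertices of a critical cell
that lie in one component are stacked along a line. Hence the cocycle is invariant under the
rewriting map `R`, and therefore under its stable power; on combinations of critical cells it reads
off the coefficient of `c`. So all coefficients of a Morse boundary are zero
(`morseBoundary_eq_zero`).

If `f` is not an edge of `T`, then for its ends to lie in the same component it matters how `T` is
chosen. As `Γ` does not contain `S₀`, every circle of `Γ` has at most one essential vertex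
(`cycle_essential_unique`), and `T` cuts each circle at an edge that contains this vertex,
if there is one (`exists_cutting_tree`). Then the edges of a critical cell, which are edges outside
`T` or edges at branching vertices of `T`, cannot separate the ends of an edge that is disjoint from
them and lies outside `T` (`Critical.reachable_of_disjoint`).

The numbering of the vertices enters by two properties: the smaller neighbours of the vertices form
a parent function of the tree, and all descendants of a vertex precede its larger siblings
(`descendant_lt_sibling`). Both follow from the fact that the boundary tour runs through a branch of
the tree in one go (`tour_of_side`).

The matching `W` has a description without recursion: a cell is collapsible when the smallest of its
unblocked vertices and respectful edges is an edge (`collapsible_iff`). The powers of `R` stabilize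
because rewriting decreases a lexicographic quantity (`complexity_face_lt`).
-/

namespace GraphBraid

universe u

/-! ### Distances in a tree -/

section Tree

variable {V : Type*} {T : SimpleGraph V}

/-- In a tree a vertex has at most one neighbour that is closer to a given vertex. -/
theorem closer_neighbor_unique (hT : T.IsTree) {x a b c : V} (hab : T.Adj a b) (hcb : T.Adj c b)
    (ha : T.dist x a < T.dist x b) (hc : T.dist x c < T.dist x b) : a = c := by
  have key : ∀ {y : V} (h : T.Adj y b), T.dist x y < T.dist x b →
      ∃ p : T.Walk x y, (p.concat h).IsPath := by
    intro y h hy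
    obtain ⟨p, hp⟩ := hT.connected.exists_walk_length_eq_dist x y
    refine ⟨p, SimpleGraph.Walk.isPath_of_length_eq_dist _ ?_⟩
    have h1 := hT.dist_eq_dist_add_one_of_adj x h
    rw [SimpleGraph.Walk.length_concat, hp]
    omega
  obtain ⟨p, hp⟩ := key hab ha
  obtain ⟨q, hq⟩ := key hcb hc
  have h := congrArg Subtype.val ((hT.isAcyclic.subsingleton_path x b).elim ⟨_, hp⟩ ⟨_, hq⟩)
  have h2 := congrArg SimpleGraph.Walk.penultimate h
  simpa using h2

theorem exists_closer_neighbor (hT : T.Connected) {x b : V} (h : x ≠ b) :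
    ∃ a, T.Adj a b ∧ T.dist x a < T.dist x b := by
  obtain ⟨p, hp⟩ := hT.exists_walk_length_eq_dist b x
  cases p with
  | nil => exact absurd rfl h
  | @cons _ a _ h' q =>
    refine ⟨a, h'.symm, ?_⟩
    have h1 := T.dist_le q
    rw [T.dist_comm (u := a)] at h1
    rw [T.dist_comm (u := x) (v := b)]
    simp only [SimpleGraph.Walk.length_cons] at hp
    omega

/-- The vertices on the side of `b` of an edge `ab` of a tree. -/
def side (T : SimpleGraph V) (a b : V) : Set V := {x | T.dist x b < T.dist x a}

theorem mem_side {a b x : V} : x ∈ side T a b ↔ T.dist x b < T.dist x a := Iff.rfl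

theorem right_mem_side (hT : T.Connected) {a b : V} (h : T.Adj a b) : b ∈ side T a b := by
  rw [mem_side, SimpleGraph.dist_self]
  exact hT.pos_dist_of_ne h.ne'

theorem left_notMem_side {a b : V} : a ∉ side T a b := by
  simp [mem_side]

/-- The only edge between the two sides of an edge `ab` of a tree is `ab` itself. -/
theorem side_crossing (hT : T.IsTree) {w v p q : V} (hwv : T.Adj w v) (hpq : T.Adj p q)
    (hp : p ∉ side T w v) (hq : q ∈ side T w v) : p = w ∧ q = v := by
  rw [mem_side] at hp hq
  have c := hT.connected
  have h1 := hT.dist_eq_dist_add_one_of_adj p hwv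
  have h2 := hT.dist_eq_dist_add_one_of_adj q hwv
  have h3 : T.dist p v ≤ 1 + T.dist q v := by
    have := c.dist_triangle (u := p) (v := q) (w := v)
    rwa [SimpleGraph.dist_eq_one_iff_adj.2 hpq] at this
  have h4 : T.dist q w ≤ 1 + T.dist p w := by
    have := c.dist_triangle (u := q) (v := p) (w := w)
    rwa [SimpleGraph.dist_eq_one_iff_adj.2 hpq.symm] at this
  have hpw : p = w := by
    by_contra hne
    obtain ⟨r, hr, hlt⟩ := exists_closer_neighbor c (x := w) (b := p) (Ne.symm hne)
    rw [T.dist_comm (v := r), T.dist_comm (v := p)] at hlt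
    have h5 : T.dist r v ≤ T.dist r w + 1 := by
      have := c.dist_triangle (u := r) (v := w) (w := v)
      rwa [SimpleGraph.dist_eq_one_iff_adj.2 hwv] at this
    have : r = q := by
      apply closer_neighbor_unique hT (x := v) hr hpq.symm
      · rw [T.dist_comm (v := r), T.dist_comm (v := p)]; omega
      · rw [T.dist_comm (v := q), T.dist_comm (v := p)]; omega
    subst this
    omega
  refine ⟨hpw, ?_⟩
  subst hpw
  rw [SimpleGraph.dist_self] at *
  exact (c.dist_eq_zero_iff).1 (by omega)

/-- The side of `b` of `ab` is composed of `b` and the sides of the other edges at `b`. -/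
theorem exists_mem_side (hT : T.IsTree) {a b x : V} (hab : T.Adj a b) (hx : x ∈ side T a b)
    (hne : x ≠ b) : ∃ c, T.Adj b c ∧ c ≠ a ∧ x ∈ side T b c := by
  obtain ⟨c, hc, hlt⟩ := exists_closer_neighbor hT.connected hne
  refine ⟨c, hc.symm, ?_, hlt⟩
  rintro rfl
  rw [mem_side] at hx
  omega

theorem side_subset_side (hT : T.IsTree) {a b c : V} (hab : T.Adj a b) (hbc : T.Adj b c)
    (hca : c ≠ a) : side T b c ⊆ side T a b := by
  intro x hx
  rw [mem_side] at *
  by_contra h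
  have h1 := hT.dist_eq_dist_add_one_of_adj x hab
  exact hca (closer_neighbor_unique hT hbc.symm hab hx (by omega))

end Tree

/-! ### The boundary tour of a planar tree -/

section Tour

variable {V : Type*} {T : SimpleGraph V} (rot : ∀ v : V, Equiv.Perm (T.neighborSet v))

theorem boundaryStep_fst (d : T.Dart) : (boundaryStep rot d).fst = d.snd := rfl

/-- The tour that enters a subtree through the oriented edge `d` runs through the whole subtree,
without leaving it, and then comes back along the reverse of `d`: at `b = d.snd` it makes an
excursion of the same kind into each of the branches at `b`. -/
theorem tour_of_side [Finite V] (hT : T.IsTree)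
    (hrot : ∀ (v : V) (a b : T.neighborSet v), (rot v).SameCycle a b) (d : T.Dart) :
    ∃ k : ℕ, 1 ≤ k ∧ (boundaryStep rot)^[k] d = d.symm ∧
      (∀ j, 1 ≤ j → j ≤ k → ((boundaryStep rot)^[j] d).fst ∈ side T d.fst d.snd) ∧
      ∀ x ∈ side T d.fst d.snd, ∃ j, 1 ≤ j ∧ j ≤ k ∧ ((boundaryStep rot)^[j] d).fst = x := by
  induction hN : (side T d.fst d.snd).ncard using Nat.strong_induction_on generalizing d with
  | _ N ih =>
  obtain ⟨⟨a, b⟩, hab⟩ := d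
  change T.Adj a b at hab
  dsimp only at hN ⊢
  set a' : T.neighborSet b := ⟨a, hab.symm⟩
  set ρ := rot b
  set S := side T a b
  have hbS : b ∈ S := right_mem_side hT.connected hab
  have hpos : ∃ m, (ρ ^ (m + 1)) a' = a' := by
    refine ⟨orderOf ρ - 1, ?_⟩
    rw [Nat.sub_add_cancel (orderOf_pos ρ), pow_orderOf_eq_one]
    rfl
  classical
  set M := Nat.find hpos
  -- the tour after the excursions into the first `m` branches at `b`
  have step : ∀ m ≤ M, ∃ k, 1 ≤ k ∧
      (boundaryStep rot)^[k] ⟨(a, b), hab⟩ =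
        ⟨(b, ((ρ ^ (m + 1)) a' : T.neighborSet b)), ((ρ ^ (m + 1)) a').2⟩ ∧
      (∀ j, 1 ≤ j → j ≤ k → ((boundaryStep rot)^[j] ⟨(a, b), hab⟩).fst ∈ S) ∧
      (∃ j, 1 ≤ j ∧ j ≤ k ∧ ((boundaryStep rot)^[j] ⟨(a, b), hab⟩).fst = b) ∧
      ∀ l, 1 ≤ l → l ≤ m → ∀ x ∈ side T b ((ρ ^ l) a' : T.neighborSet b),
        ∃ j, 1 ≤ j ∧ j ≤ k ∧ ((boundaryStep rot)^[j] ⟨(a, b), hab⟩).fst = x := by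
    intro m
    induction m with
    | zero =>
      intro _
      refine ⟨1, le_rfl, rfl, ?_, ⟨1, le_rfl, le_rfl, rfl⟩, fun l h1 h2 => by omega⟩
      intro j h1 h2
      obtain rfl : j = 1 := by omega
      exact hbS
    | succ m ihm =>
      intro hm
      obtain ⟨k, hk1, hk, hkS, hkb, hkl⟩ := ihm (by omega)
      set c := (ρ ^ (m + 1)) a'
      have hca : (c : V) ≠ a := by
        intro h
        exact Nat.find_min hpos (m := m) (by omega) (Subtype.ext h)
      have hsub : side T b c ⊆ S := side_subset_side hT hab c.2 hca
      have hss : side T b c ⊂ S := by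
        refine hsub.ssubset_of_mem_notMem hbS left_notMem_side
      obtain ⟨k', hk'1, hk', hk'S, hk'x⟩ := ih _ (by
        rw [← hN]; exact Set.ncard_lt_ncard hss (Set.toFinite _)) ⟨(b, c), c.2⟩ rfl
      dsimp only at hk'S hk'x
      have hadd : ∀ j, (boundaryStep rot)^[k + j] ⟨(a, b), hab⟩ =
          (boundaryStep rot)^[j] ⟨(b, c), c.2⟩ := by
        intro j
        rw [Nat.add_comm, Function.iterate_add_apply, hk]
      refine ⟨k + (k' + 1), by omega, ?_, ?_, ?_, ?_⟩
      · rw [hadd, Function.iterate_succ_apply', hk']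
        have h2 : (ρ ^ (m + 1 + 1)) a' = ρ c := by
          rw [pow_succ' ρ (m + 1)]; rfl
        rw [h2]
        rfl
      · intro j h1 h2
        rcases le_or_gt j k with h3 | h3
        · exact hkS j h1 h3
        · obtain ⟨j, rfl⟩ : ∃ j', j = k + j' := ⟨j - k, by omega⟩
          rw [hadd]
          rcases Nat.lt_or_ge j (k' + 1) with h4 | h4
          · exact hsub (hk'S j (by omega) (by omega))
          · obtain rfl : j = k' + 1 := by omega
            rw [Function.iterate_succ_apply', hk']
            exact hbS
      · obtain ⟨j, h1, h2, h3⟩ := hkb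
        exact ⟨j, h1, by omega, h3⟩
      · intro l h1 h2 x hx
        rcases Nat.lt_or_ge l (m + 1) with h3 | h3
        · obtain ⟨j, h4, h5, h6⟩ := hkl l h1 (by omega) x hx
          exact ⟨j, h4, by omega, h6⟩
        · obtain rfl : l = m + 1 := by omega
          obtain ⟨j, h4, h5, h6⟩ := hk'x x hx
          exact ⟨k + j, by omega, by omega, by rw [hadd, h6]⟩
  obtain ⟨k, hk1, hk, hkS, hkb, hkl⟩ := step M le_rfl
  refine ⟨k, hk1, ?_, hkS, ?_⟩
  · rw [hk, Nat.find_spec hpos]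
    rfl
  · intro x hx
    by_cases hxb : x = b
    · subst hxb; exact hkb
    obtain ⟨c, hbc, hca, hxc⟩ := exists_mem_side hT hab hx hxb
    -- the branch `c` is reached after fewer than `M + 1` turns
    have hcyc : ∃ l, (ρ ^ l) a' = ⟨c, hbc⟩ := by
      obtain ⟨l, _, hl⟩ := (hrot b a' ⟨c, hbc⟩).exists_pow_eq'
      exact ⟨l, hl⟩
    have hl := Nat.find_spec hcyc
    set l := Nat.find hcyc
    have hl1 : 1 ≤ l := by
      rcases Nat.eq_zero_or_pos l with h0 | h0
      · rw [h0] at hl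
        exact absurd (congrArg Subtype.val hl).symm hca
      · exact h0
    have hlM : l ≤ M := by
      by_contra h
      refine Nat.find_min hcyc (m := l - (M + 1)) (by omega) ?_
      have h2 : (ρ ^ (l - (M + 1))) ((ρ ^ (M + 1)) a') = ⟨c, hbc⟩ := by
        rw [← Equiv.Perm.mul_apply, ← pow_add, Nat.sub_add_cancel (by omega), hl]
      rwa [Nat.find_spec hpos] at h2
    exact hkl l hl1 hlM x (by rw [hl]; exact hxc)

variable (start : T.Dart)

theorem firstVisit_le {v : V} {k : ℕ} (h : ((boundaryStep rot)^[k] start).fst = v) :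
    firstVisit rot start v ≤ k := Nat.sInf_le h

variable {rot start}

/-- A tour that begins at a leaf meets every vertex. -/
theorem exists_visit [Finite V] (hT : T.IsTree)
    (hrot : ∀ (v : V) (a b : T.neighborSet v), (rot v).SameCycle a b)
    (hstart : valency T start.fst = 1) (x : V) :
    ∃ k, ((boundaryStep rot)^[k] start).fst = x := by
  by_cases hx : x = start.fst
  · exact ⟨0, hx.symm⟩
  obtain ⟨c, hc, hlt⟩ := exists_closer_neighbor hT.connected hx
  obtain ⟨z, hz⟩ := Set.ncard_eq_one.1 hstart
  have h1 : c ∈ T.neighborSet start.fst := hc.symm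
  have h2 : start.snd ∈ T.neighborSet start.fst := start.adj
  rw [hz, Set.mem_singleton_iff] at h1 h2
  obtain ⟨k, -, -, -, h⟩ := tour_of_side rot hT hrot start
  obtain ⟨j, -, -, hj⟩ := h x (by rw [mem_side, h2, ← h1]; exact hlt)
  exact ⟨j, hj⟩

theorem visit_firstVisit [Finite V] (hT : T.IsTree)
    (hrot : ∀ (v : V) (a b : T.neighborSet v), (rot v).SameCycle a b)
    (hstart : valency T start.fst = 1) (x : V) :
    ((boundaryStep rot)^[firstVisit rot start x] start).fst = x :=
  Nat.sInf_mem (s := {k : ℕ | ((boundaryStep rot)^[k] start).fst = x})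
    (exists_visit hT hrot hstart x)

theorem firstVisit_injective [Finite V] (hT : T.IsTree)
    (hrot : ∀ (v : V) (a b : T.neighborSet v), (rot v).SameCycle a b)
    (hstart : valency T start.fst = 1) : Function.Injective (firstVisit rot start) := by
  intro x y h
  rw [← visit_firstVisit hT hrot hstart x, h, visit_firstVisit hT hrot hstart y]

/-- A vertex `v` is first met on coming along the edge `wv` from the vertex `w` before it on the
way from the base vertex. -/
theorem firstVisit_eq_succ [Finite V] (hT : T.IsTree)
    (hrot : ∀ (v : V) (a b : T.neighborSet v), (rot v).SameCycle a b)
    (hstart : valency T start.fst = 1) {w v : V} (hwv : T.Adj w v)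
    (hlt : T.dist start.fst w < T.dist start.fst v) :
    ∃ j, firstVisit rot start v = j + 1 ∧ (boundaryStep rot)^[j] start = ⟨(w, v), hwv⟩ := by
  have hv := visit_firstVisit hT hrot hstart v
  rcases hf : firstVisit rot start v with _ | j
  · rw [hf] at hv
    change start.fst = v at hv
    rw [hv, SimpleGraph.dist_self] at hlt
    omega
  refine ⟨j, rfl, ?_⟩
  rw [hf, Function.iterate_succ_apply', boundaryStep_fst] at hv
  have hadj : T.Adj ((boundaryStep rot)^[j] start).fst v := by
    have := ((boundaryStep rot)^[j] start).adj
    rwa [hv] at this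
  have hfst : ((boundaryStep rot)^[j] start).fst = w := by
    by_contra hne
    have hS : ((boundaryStep rot)^[j] start).fst ∈ side T w v := by
      by_contra h
      exact hne (side_crossing hT hwv hadj h (right_mem_side hT.connected hwv)).1
    have h0 : start.fst ∉ side T w v := by rw [mem_side]; omega
    -- the tour enters the side of `v` for the first time before step `j`
    classical
    have hex : ∃ i, ((boundaryStep rot)^[i] start).fst ∈ side T w v := ⟨j, hS⟩
    have hi := Nat.find_spec hex
    have hij := Nat.find_le (h := hex) hS
    rcases hii : Nat.find hex with _ | i
    · rw [hii] at hi
      exact h0 hi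
    have hi' := Nat.find_min hex (m := i) (by omega)
    rw [hii, Function.iterate_succ_apply', boundaryStep_fst] at hi
    have hc := side_crossing hT hwv ((boundaryStep rot)^[i] start).adj hi' hi
    have h3 : firstVisit rot start v ≤ i + 1 := by
      apply firstVisit_le
      rw [Function.iterate_succ_apply', boundaryStep_fst]
      exact hc.2
    omega
  ext <;> assumption

/-- Every vertex on the far side of `wv` is met before any vertex that is met after `v` and lies on
the near side. -/
theorem firstVisit_lt_of_side [Finite V] (hT : T.IsTree)
    (hrot : ∀ (v : V) (a b : T.neighborSet v), (rot v).SameCycle a b)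
    (hstart : valency T start.fst = 1) {w v : V} (hwv : T.Adj w v)
    (hlt : T.dist start.fst w < T.dist start.fst v) {x u : V} (hx : x ∈ side T w v)
    (hu : u ∉ side T w v) (hvu : firstVisit rot start v < firstVisit rot start u) :
    firstVisit rot start x < firstVisit rot start u := by
  obtain ⟨j, hj, hd⟩ := firstVisit_eq_succ hT hrot hstart hwv hlt
  obtain ⟨k, -, -, hkS, hkx⟩ := tour_of_side rot hT hrot ⟨(w, v), hwv⟩
  have hadd : ∀ i, (boundaryStep rot)^[j + i] start =
      (boundaryStep rot)^[i] ⟨(w, v), hwv⟩ := by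
    intro i
    rw [Nat.add_comm, Function.iterate_add_apply, hd]
  obtain ⟨i, hi1, hi2, hi⟩ := hkx x hx
  have h1 : firstVisit rot start x ≤ j + i := firstVisit_le _ _ (by rw [hadd, hi])
  by_contra hcon
  obtain ⟨l, hl⟩ : ∃ l, firstVisit rot start u = j + l := ⟨firstVisit rot start u - j, by omega⟩
  have h2 := visit_firstVisit hT hrot hstart u
  rw [hl, hadd] at h2
  have h3 := hkS l (by omega) (by omega)
  rw [h2] at h3
  exact hu h3

end Tour

/-! ### The order of the vertices of a planar tree -/

/-- Every planar tree with a base vertex of valency 1 has a numbering by the boundary tour. -/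
theorem exists_orderedTree {V : Type u} [Fintype V] [Nontrivial V] {Γ : SimpleGraph V} {n : ℕ}
    {T : SimpleGraph V} (le : T ≤ Γ) (hT : T.IsTree) (hsub : SufficientlySubdivided n T) :
    ∃ D : OrderedTree Γ n, D.T = T := by
  classical
  have hrot : ∀ v : V, ∃ ρ : Equiv.Perm (T.neighborSet v), ∀ a b, ρ.SameCycle a b := by
    intro v
    obtain ⟨k, ⟨e⟩⟩ := Finite.exists_equiv_fin (T.neighborSet v)
    refine ⟨e.permCongr.symm (finRotate k), fun a b => ?_⟩
    have h : (finRotate k).SameCycle (e a) (e b) := by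
      match k, e with
      | 0, e => exact (e a).elim0
      | 1, e => rw [Subsingleton.elim (e a) (e b)]
      | k + 2, e =>
        exact isCycle_finRotate.sameCycle
          (by rw [← Equiv.Perm.mem_support, support_finRotate]; exact Finset.mem_univ _)
          (by rw [← Equiv.Perm.mem_support, support_finRotate]; exact Finset.mem_univ _)
    obtain ⟨i, hi⟩ := h
    refine ⟨i, ?_⟩
    have h3 : (e.permCongr.symm (finRotate k)) ^ i = e.permCongr.symm (finRotate k ^ i) :=
      (map_zpow e.permCongrHom.symm (finRotate k) i).symm
    rw [h3]
    apply e.injective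
    rw [← hi]
    simp
  choose rot hrot using hrot
  obtain ⟨x, hx⟩ := hT.exists_vert_degree_one_of_nontrivial
  have hval : valency T x = 1 := by
    rw [valency, Set.ncard_eq_toFinset_card', ← hx]
    rfl
  obtain ⟨y, hy⟩ := Set.ncard_eq_one.1 hval
  have hxy : T.Adj x y := by
    have : y ∈ T.neighborSet x := by rw [hy]; rfl
    exact this
  set start : T.Dart := ⟨(x, y), hxy⟩
  have hinj := firstVisit_injective (start := start) hT hrot hval
  let _ : LinearOrder V := LinearOrder.lift' (firstVisit rot start) hinj
  let num : V ≃o Fin (Fintype.card V) := (Fintype.orderIsoFinOfCardEq V rfl).symm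
  exact ⟨⟨T, le, hT, hsub, rot, hrot, start, hval, num.toEquiv, fun v w => num.lt_iff_lt⟩, rfl⟩

namespace OrderedTree

variable {V : Type u} [Fintype V] {Γ : SimpleGraph V} {n : ℕ} (D : OrderedTree Γ n)

/-- `w` is the parent of `v`: the neighbour of `v` in the tree with a smaller number. -/
def Parent (w v : V) : Prop := D.T.Adj w v ∧ D.num w < D.num v

/-- The base vertex. -/
def root : V := D.start.fst

theorem parent_iff_dist {w v : V} :
    D.Parent w v ↔ D.T.Adj w v ∧ D.T.dist D.root w < D.T.dist D.root v := by
  have key : ∀ {w v : V}, D.T.Adj w v → D.T.dist D.root w < D.T.dist D.root v →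
      D.num w < D.num v := by
    intro w v h hlt
    rw [D.num_lt_iff]
    obtain ⟨j, hj, hd⟩ := firstVisit_eq_succ D.isTree D.rot_cyclic D.valency_start h hlt
    have : firstVisit D.rot D.start w ≤ j := firstVisit_le _ _ (by rw [hd])
    omega
  refine and_congr_right fun h => ⟨fun hlt => ?_, key h⟩
  by_contra hcon
  have h1 := D.isTree.dist_ne_of_adj D.root h
  exact lt_asymm hlt (key h.symm (by omega))

variable {D}

theorem Parent.adj {w v : V} (h : D.Parent w v) : D.T.Adj w v := h.1

theorem Parent.lt {w v : V} (h : D.Parent w v) : D.num w < D.num v := h.2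

theorem Parent.unique {w w' v : V} (h : D.Parent w v) (h' : D.Parent w' v) : w = w' := by
  rw [parent_iff_dist] at h h'
  exact closer_neighbor_unique D.isTree h.1 h'.1 h.2 h'.2

theorem parent_or_parent {w v : V} (h : D.T.Adj w v) : D.Parent w v ∨ D.Parent v w := by
  rcases lt_trichotomy (D.num w) (D.num v) with h1 | h1 | h1
  · exact Or.inl ⟨h, h1⟩
  · exact absurd (D.num.injective h1) h.ne
  · exact Or.inr ⟨h.symm, h1⟩

variable (D)

theorem exists_parent {v : V} (h : v ≠ D.root) : ∃ w, D.Parent w v := by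
  obtain ⟨w, hw, hlt⟩ := exists_closer_neighbor D.isTree.connected (x := D.root) h.symm
  exact ⟨w, D.parent_iff_dist.2 ⟨hw, hlt⟩⟩

theorem valency_root : valency D.T D.root = 1 := D.valency_start

/-- A vertex with two children has valency at least 3: it cannot be the base vertex. -/
theorem three_le_valency {m x y : V} (hx : D.Parent m x) (hy : D.Parent m y) (hxy : x ≠ y) :
    3 ≤ valency D.T m := by
  have hm : m ≠ D.root := by
    rintro rfl
    have h := D.valency_root
    have h2 : ({x, y} : Set V) ⊆ D.T.neighborSet D.root := by
      rintro z (rfl | rfl)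
      · exact hx.adj
      · exact hy.adj
    have := Set.ncard_le_ncard h2 (Set.toFinite _)
    rw [Set.ncard_pair hxy] at this
    rw [valency] at h
    omega
  obtain ⟨w, hw⟩ := D.exists_parent hm
  have h2 : ({w, x, y} : Set V) ⊆ D.T.neighborSet m := by
    rintro z (rfl | rfl | rfl)
    · exact hw.adj.symm
    · exact hx.adj
    · exact hy.adj
  have h3 := Set.ncard_le_ncard h2 (Set.toFinite _)
  have hwx : w ≠ x := by rintro rfl; exact lt_asymm hw.lt hx.lt
  have hwy : w ≠ y := by rintro rfl; exact lt_asymm hw.lt hy.lt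
  rw [Set.ncard_eq_three.2 ⟨w, x, y, hwx, hwy, hxy, rfl⟩] at h3
  exact h3

variable {D}

theorem mem_side_of_descendant {p v x : V} (hv : D.Parent p v)
    (h : Relation.ReflTransGen D.Parent v x) : x ∈ side D.T p v := by
  induction h with
  | refl => exact right_mem_side D.isTree.connected hv.adj
  | tail _ hxy ih =>
    by_contra hy
    obtain ⟨rfl, rfl⟩ := side_crossing D.isTree hv.adj hxy.adj.symm hy ih
    exact lt_asymm hv.lt hxy.lt

/-- The numbering is a preorder traversal: the descendants of a vertex precede its larger
siblings. -/
theorem descendant_lt_sibling {p v u x : V} (hv : D.Parent p v) (hu : D.Parent p u)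
    (hlt : D.num v < D.num u) (h : Relation.ReflTransGen D.Parent v x) : D.num x < D.num u := by
  rw [num_lt_iff] at hlt ⊢
  refine firstVisit_lt_of_side D.isTree D.rot_cyclic D.valency_start hv.adj
    (D.parent_iff_dist.1 hv).2 (mem_side_of_descendant hv h) ?_ hlt
  intro hmem
  rw [mem_side, D.T.dist_comm (v := p), SimpleGraph.dist_eq_one_iff_adj.2 hu.adj] at hmem
  have : u = v := D.isTree.connected.dist_eq_zero_iff.1 (by omega)
  subst this
  exact lt_irrefl _ hlt

end OrderedTree

/-! ### The matching of the cells -/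

namespace Cell

variable {V : Type u} {Γ : SimpleGraph V} {n i : ℕ}

theorem notMem_verts_of_mem_edge (c : Cell Γ n i) {e : Sym2 V} (he : e ∈ c.edges) {x : V}
    (hx : x ∈ e) : x ∉ c.verts := fun h => c.disjoint_verts x h e he hx

variable [DecidableEq V]

theorem eq_of_face_eq (b : Cell Γ n (i + 1)) {e f : Sym2 V} (he : e ∈ b.edges)
    (hf : f ∈ b.edges) {x y : V} (hx : x ∈ e) (hy : y ∈ f)
    (h : b.face e he x hx = b.face f hf y hy) : e = f ∧ x = y := by
  have h1 : insert x b.verts = insert y b.verts := congrArg Cell.verts h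
  have hxy : x = y := by
    have : x ∈ insert y b.verts := h1 ▸ Finset.mem_insert_self x b.verts
    rcases Finset.mem_insert.1 this with h2 | h2
    · exact h2
    · exact absurd h2 (b.notMem_verts_of_mem_edge he hx)
  subst hxy
  exact ⟨b.disjoint_edges e he f hf x hx hy, rfl⟩

theorem face_slide (c : Cell Γ n i) {w v : V} (hv : v ∈ c.verts) (h : Γ.Adj w v)
    (hw : ¬ c.Occupied w) (hmem : s(w, v) ∈ (c.slide w v hv h hw).edges) :
    (c.slide w v hv h hw).face s(w, v) hmem v (Sym2.mem_mk_right w v) = c := by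
  have h1 : s(w, v) ∉ c.edges := fun he => hw (Or.inr ⟨_, he, Sym2.mem_mk_left w v⟩)
  ext : 1
  · exact Finset.insert_erase hv
  · exact Finset.erase_insert h1

end Cell

namespace OrderedTree

variable {V : Type u} [Fintype V] {Γ : SimpleGraph V} {n i : ℕ} (D : OrderedTree Γ n)

/-- The edge `w-v` of `c` belongs to the tree, `v` being its initial vertex, and no smaller vertex
of `c` is a child of `w`. -/
def Respectful (c : Cell Γ n i) (w v : V) : Prop :=
  s(w, v) ∈ c.edges ∧ D.Parent w v ∧ ∀ u ∈ c.verts, D.Parent w u → D.num v < D.num u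

/-- The edge `w-v` of `c` is respectful, and its initial vertex `v` is smaller than every unblocked
vertex and than the initial vertex of every other respectful edge of `c`. -/
def MinEdge (c : Cell Γ n i) (w v : V) : Prop :=
  D.Respectful c w v ∧ (∀ w' v', D.UnblockedVia c w' v' → D.num v < D.num v') ∧
    ∀ w' v', D.Respectful c w' v' → D.num v ≤ D.num v'

variable {D}

theorem UnblockedVia.parent {c : Cell Γ n i} {w v : V} (h : D.UnblockedVia c w v) :
    D.Parent w v := ⟨h.2.1, h.2.2.1⟩

theorem SmallestUnblocked.unique {c : Cell Γ n i} {w v w' v' : V}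
    (h : D.SmallestUnblocked c w v) (h' : D.SmallestUnblocked c w' v') : w = w' ∧ v = v' := by
  have hv : v = v' := D.num.injective (le_antisymm (h.2 _ _ h'.1) (h'.2 _ _ h.1))
  subst hv
  exact ⟨h.1.parent.unique h'.1.parent, rfl⟩

theorem exists_smallestUnblocked {c : Cell Γ n i} {w v : V} (h : D.UnblockedVia c w v) :
    ∃ w v, D.SmallestUnblocked c w v := by
  obtain ⟨v', ⟨w', h'⟩, hmin⟩ := Set.exists_min_image {v | ∃ w, D.UnblockedVia c w v} D.num
    (Set.toFinite _) ⟨v, w, h⟩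
  exact ⟨w', v', h', fun w'' v'' h'' => hmin v'' ⟨w'', h''⟩⟩

theorem exists_smallestRespectful {c : Cell Γ n i} {w v : V} (h : D.Respectful c w v) :
    ∃ w' v', D.Respectful c w' v' ∧ (∀ w'' v'', D.Respectful c w'' v'' → D.num v' ≤ D.num v'') ∧
      D.num v' ≤ D.num v := by
  obtain ⟨v', ⟨w', h'⟩, hmin⟩ := Set.exists_min_image {v | ∃ w, D.Respectful c w v} D.num
    (Set.toFinite _) ⟨v, w, h⟩
  exact ⟨w', v', h', fun w'' v'' h'' => hmin v'' ⟨w'', h''⟩, hmin v ⟨w, h⟩⟩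

variable [DecidableEq V]

theorem push_eq_some_iff {c : Cell Γ n i} {b : Cell Γ n (i + 1)} :
    D.push c = some b ↔ ∃ w v, ∃ h : D.SmallestUnblocked c w v,
      b = c.slide w v h.1.1 (D.le h.1.2.1) h.1.2.2.2 := by
  unfold push
  split_ifs with h
  · rw [Option.some_inj]
    constructor
    · rintro rfl
      exact ⟨_, _, h.choose_spec, rfl⟩
    · rintro ⟨w, v, h', rfl⟩
      obtain ⟨h1, h2⟩ := h.choose_spec.unique h'
      congr 1
  · simp only [false_iff]
    rintro ⟨w, v, h', -⟩
    exact h ⟨(w, v), h'⟩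

/-- If no respectful edge comes before the smallest unblocked vertex, then pushing this vertex
makes a cell whose smallest item is the new edge. -/
theorem minEdge_slide {c : Cell Γ n i} {w v : V} (h : D.SmallestUnblocked c w v)
    (hmin : ∀ w' v', ¬ D.MinEdge c w' v') :
    D.MinEdge (c.slide w v h.1.1 (D.le h.1.2.1) h.1.2.2.2) w v := by
  have hc : ∀ w' v', D.Respectful c w' v' → D.num v < D.num v' := by
    intro w' v' h'
    by_contra hle
    rw [not_lt] at hle
    obtain ⟨w₁, v₁, h₁, hmin₁, hle₁⟩ := exists_smallestRespectful h'
    refine hmin w₁ v₁ ⟨h₁, fun w₂ v₂ h₂ => ?_, hmin₁⟩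
    refine lt_of_lt_of_le (lt_of_le_of_ne (hle₁.trans hle) ?_) (h.2 w₂ v₂ h₂)
    intro heq
    rw [D.num.injective heq] at h₁
    exact c.notMem_verts_of_mem_edge h₁.1 (Sym2.mem_mk_right _ _) h.1.1
  have hwv := h.1.parent
  have hw := h.1.2.2.2
  have hvert : ∀ u, u ∈ (c.slide w v h.1.1 (D.le h.1.2.1) h.1.2.2.2).verts →
      u ≠ v ∧ u ∈ c.verts := fun u hu => Finset.mem_erase.1 hu
  have hresp : ∀ w' v', D.Respectful (c.slide w v h.1.1 (D.le h.1.2.1) h.1.2.2.2) w' v' →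
      D.num v ≤ D.num v' := by
    rintro w' v' ⟨h1, h2, h3⟩
    by_contra hlt
    rw [not_le] at hlt
    rcases Finset.mem_insert.1 h1 with h1 | h1
    · rcases Sym2.eq_iff.1 h1 with ⟨rfl, rfl⟩ | ⟨rfl, rfl⟩
      · exact lt_irrefl _ hlt
      · exact lt_asymm h2.lt hwv.lt
    · refine lt_asymm hlt (hc w' v' ⟨h1, h2, fun u hu hu' => ?_⟩)
      by_cases huv : u = v
      · rw [huv]; exact hlt
      · exact h3 u (Finset.mem_erase.2 ⟨huv, hu⟩) hu'
  refine ⟨⟨Finset.mem_insert_self _ _, hwv, fun u hu hu' => ?_⟩, fun w' v' h' => ?_, hresp⟩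
  · obtain ⟨h1, h2⟩ := hvert u hu
    refine lt_of_le_of_ne (h.2 w u ⟨h2, hu'.1, hu'.2, hw⟩) fun h3 => h1 (D.num.injective h3).symm
  · obtain ⟨h1, h2⟩ := hvert v' h'.1
    refine lt_of_le_of_ne (h.2 w' v' ⟨h2, h'.2.1, h'.2.2.1, fun hocc => h'.2.2.2 ?_⟩)
      fun h3 => h1 (D.num.injective h3).symm
    rcases hocc with hocc | ⟨e, he, hocc⟩
    · by_cases hw'v : w' = v
      · exact Or.inr ⟨s(w, v), Finset.mem_insert_self _ _, by simp [hw'v]⟩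
      · exact Or.inl (Finset.mem_erase.2 ⟨hw'v, hocc⟩)
    · exact Or.inr ⟨e, Finset.mem_insert_of_mem he, hocc⟩

/-- On the cells that are not collapsible, `W` is `push`. -/
theorem W_eq_of_not_collapsible {c : Cell Γ n i} (h : ¬ D.Collapsible c) : D.W i c = D.push c := by
  cases i with
  | zero => rfl
  | succ i => exact if_neg h

theorem W_eq_some {c : Cell Γ n i} {b : Cell Γ n (i + 1)} (h : D.W i c = some b) :
    ¬ D.Collapsible c ∧ D.push c = some b := by
  cases i with
  | zero => exact ⟨id, h⟩
  | succ i =>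
    by_cases hc : ∃ b : Cell Γ n i, D.W i b = some c
    · rw [W, if_pos hc] at h
      exact absurd h (by simp)
    · rw [W, if_neg hc] at h
      exact ⟨hc, h⟩

/-- A cell is collapsible when its smallest item, among the unblocked vertices and the respectful
edges, is an edge. -/
theorem collapsible_iff : ∀ {i : ℕ} {c : Cell Γ n i}, D.Collapsible c ↔ ∃ w v, D.MinEdge c w v
  | 0, c => by
    refine ⟨False.elim, ?_⟩
    rintro ⟨w, v, h, -⟩
    have := Finset.card_eq_zero.1 c.card_edges
    have h1 := h.1
    rw [this] at h1
    exact absurd h1 (Finset.notMem_empty _)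
  | i + 1, c => by
    constructor
    · rintro ⟨b, hb⟩
      obtain ⟨hnc, hpush⟩ := W_eq_some hb
      obtain ⟨w, v, h, rfl⟩ := push_eq_some_iff.1 hpush
      exact ⟨w, v, minEdge_slide h fun w' v' h' => hnc (collapsible_iff.2 ⟨w', v', h'⟩)⟩
    · rintro ⟨w, v, h⟩
      have hwv := h.1.2.1
      have he := h.1.1
      have hwe : w ∈ s(w, v) := Sym2.mem_mk_left w v
      have hve : v ∈ s(w, v) := Sym2.mem_mk_right w v
      set b := c.face s(w, v) he v hve
      have hbverts : ∀ u, u ∈ b.verts ↔ u = v ∨ u ∈ c.verts := fun u => Finset.mem_insert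
      have hbedges : ∀ e, e ∈ b.edges ↔ e ≠ s(w, v) ∧ e ∈ c.edges := fun e => Finset.mem_erase
      have hwb : ¬ b.Occupied w := by
        rintro (h1 | ⟨e, h1, h2⟩)
        · rcases (hbverts w).1 h1 with h1 | h1
          · exact hwv.adj.ne h1
          · exact c.notMem_verts_of_mem_edge he hwe h1
        · obtain ⟨h3, h4⟩ := (hbedges e).1 h1
          exact h3 (c.disjoint_edges e h4 _ he w h2 hwe)
      have hunb : D.UnblockedVia b w v := ⟨(hbverts v).2 (Or.inl rfl), hwv.1, hwv.2, hwb⟩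
      have hsmall : D.SmallestUnblocked b w v := by
        refine ⟨hunb, fun w' v' h' => ?_⟩
        rcases (hbverts v').1 h'.1 with rfl | hv'
        · exact le_rfl
        by_contra hlt
        rw [not_le] at hlt
        by_cases hw' : w' = w
        · subst hw'
          exact lt_asymm hlt (h.1.2.2 v' hv' h'.parent)
        refine lt_asymm hlt (h.2.1 w' v' ⟨hv', h'.2.1, h'.2.2.1, fun hocc => h'.2.2.2 ?_⟩)
        rcases hocc with hocc | ⟨e, h1, h2⟩
        · exact Or.inl ((hbverts w').2 (Or.inr hocc))
        · by_cases hee : e = s(w, v)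
          · subst hee
            rcases Sym2.mem_iff.1 h2 with h2 | h2
            · exact absurd h2 hw'
            · exact Or.inl ((hbverts w').2 (Or.inl h2))
          · exact Or.inr ⟨e, (hbedges e).2 ⟨hee, h1⟩, h2⟩
      have hnc : ¬ D.Collapsible b := by
        rw [collapsible_iff]
        rintro ⟨w', v', h'⟩
        have hlt := h'.2.1 w v hunb
        refine not_le.2 hlt (h.2.2 w' v' ⟨((hbedges _).1 h'.1.1).2, h'.1.2.1, fun u hu hu' => ?_⟩)
        exact h'.1.2.2 u ((hbverts u).2 (Or.inr hu)) hu'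
      refine ⟨b, ?_⟩
      rw [W_eq_of_not_collapsible hnc, push_eq_some_iff]
      refine ⟨w, v, hsmall, ?_⟩
      have hvc : v ∉ c.verts := c.notMem_verts_of_mem_edge he hve
      ext : 1
      · exact (Finset.erase_insert hvc).symm
      · exact (Finset.insert_erase he).symm

theorem Critical.not_unblockedVia {c : Cell Γ n i} (hc : D.Critical c) (w v : V) :
    ¬ D.UnblockedVia c w v := by
  intro h
  obtain ⟨w', v', h'⟩ := exists_smallestUnblocked h
  refine hc.1 ?_
  rw [Redundant, W_eq_of_not_collapsible hc.2, push_eq_some_iff.2 ⟨w', v', h', rfl⟩]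
  simp

theorem Critical.not_respectful {c : Cell Γ n i} (hc : D.Critical c) (w v : V) :
    ¬ D.Respectful c w v := by
  intro h
  obtain ⟨w', v', h', hmin, -⟩ := exists_smallestRespectful h
  exact hc.2 (collapsible_iff.2 ⟨w', v', h',
    fun w'' v'' h'' => absurd h'' (hc.not_unblockedVia w'' v''), hmin⟩)

/-- A cell moved by `W` is a face of its image, whose smallest item is the new edge. -/
theorem exists_minEdge_of_W_eq_some {c : Cell Γ n i} {b : Cell Γ n (i + 1)}
    (h : D.W i c = some b) : ∃ w v, ∃ hm : D.MinEdge b w v,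
      c = b.face s(w, v) hm.1.1 v (Sym2.mem_mk_right w v) := by
  obtain ⟨hnc, hpush⟩ := W_eq_some h
  obtain ⟨w, v, h', rfl⟩ := push_eq_some_iff.1 hpush
  exact ⟨w, v, minEdge_slide h' fun w' v' hm => hnc (collapsible_iff.2 ⟨w', v', hm⟩),
    (c.face_slide _ _ _ _).symm⟩

end OrderedTree

/-! ### The rewriting process terminates -/

namespace OrderedTree

variable {V : Type u} [Fintype V] {Γ : SimpleGraph V} {n i : ℕ} (D : OrderedTree Γ n)

instance : Finite (Cell Γ n i) :=
  Finite.of_injective (fun c : Cell Γ n i => (c.verts, c.edges)) fun c c' h => by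
    ext : 1
    · exact congrArg Prod.fst h
    · exact congrArg Prod.snd h

theorem init_mk {a b : V} (h : D.num a ≤ D.num b) : D.init s(a, b) = b := by simp [init, h]

theorem term_mk {a b : V} (h : D.num a ≤ D.num b) : D.term s(a, b) = a := by simp [term, h]

theorem eq_init_or_term {e : Sym2 V} {x : V} (hx : x ∈ e) : x = D.init e ∨ x = D.term e := by
  induction e with | _ a b
  rcases le_total (D.num a) (D.num b) with h | h
  · rw [D.init_mk h, D.term_mk h]
    exact (Sym2.mem_iff.1 hx).symm
  · rw [Sym2.eq_swap, D.init_mk h, D.term_mk h]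
    exact Sym2.mem_iff.1 hx

theorem term_lt_init {e : Sym2 V} (he : e ∈ Γ.edgeSet) : D.num (D.term e) < D.num (D.init e) := by
  induction e with | _ a b
  have hne : a ≠ b := Γ.ne_of_adj he
  rcases lt_or_gt_of_ne (fun h => hne (D.num.injective h)) with h | h
  · rwa [D.init_mk h.le, D.term_mk h.le]
  · rw [Sym2.eq_swap]
    rwa [D.init_mk h.le, D.term_mk h.le]

theorem exists_parent_of_mem_edgeSet {e : Sym2 V} (he : e ∈ D.T.edgeSet) :
    ∃ w v, e = s(w, v) ∧ D.Parent w v ∧ D.term e = w ∧ D.init e = v := by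
  induction e with | _ a b
  rcases parent_or_parent (D := D) he with h | h
  · exact ⟨a, b, rfl, h, D.term_mk h.lt.le, D.init_mk h.lt.le⟩
  · refine ⟨b, a, Sym2.eq_swap, h, ?_, ?_⟩
    · rw [Sym2.eq_swap, D.term_mk h.lt.le]
    · rw [Sym2.eq_swap, D.init_mk h.lt.le]

variable [DecidableEq V]

/-- The sum of the numbers of the vertices and of the initial vertices of the edges. -/
def positionWeight (c : Cell Γ n i) : ℕ :=
  ∑ v ∈ c.verts, (D.num v : ℕ) + ∑ e ∈ c.edges, (D.num (D.init e) : ℕ)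

/-- The sum of the numbers of the initial vertices of the edges. -/
def edgeWeight (c : Cell Γ n i) : ℕ := ∑ e ∈ c.edges, (D.num (D.init e) : ℕ)

open Classical in
/-- The number of edges outside the tree. -/
noncomputable def deletedCount (c : Cell Γ n i) : ℕ :=
  (c.edges.filter fun e => e ∉ D.T.edgeSet).card

open Classical in
/-- The number of edges that are not respectful. -/
noncomputable def disrespectfulCount (c : Cell Γ n i) : ℕ :=
  (c.edges.filter fun e => ¬ ∃ w v, e = s(w, v) ∧ D.Respectful c w v).card

/-- A quantity that decreases lexicographically under rewriting. Let `b = W c`, with smallest item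
`e`. Replacing an edge of `b` by its terminal vertex lowers the first entry. Replacing an edge
`f ≠ e` by its initial vertex keeps the first entry the same as for `c`, and lowers the second one
if `f` lies outside the tree, the third one if `f` is an edge of the tree that is not respectful,
and the last one if `f` is respectful, since then `ι(f) > ι(e)`. -/
noncomputable def complexity (c : Cell Γ n i) : ℕ ×ₗ ℕ ×ₗ ℕ ×ₗ ℕ :=
  toLex (D.positionWeight c, toLex (D.deletedCount c,
    toLex (D.disrespectfulCount c, D.edgeWeight c)))

variable {D}

section Faces

variable {b : Cell Γ n (i + 1)} {f : Sym2 V} (hf : f ∈ b.edges)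

theorem edgeWeight_face {x : V} (hx : x ∈ f) :
    D.edgeWeight (b.face f hf x hx) + D.num (D.init f) = D.edgeWeight b :=
  Finset.sum_erase_add _ _ hf

theorem positionWeight_face {x : V} (hx : x ∈ f) :
    D.positionWeight (b.face f hf x hx) + D.num (D.init f) = D.positionWeight b + D.num x := by
  have h1 := edgeWeight_face (D := D) hf hx
  have h2 : ∑ v ∈ (b.face f hf x hx).verts, (D.num v : ℕ) =
      D.num x + ∑ v ∈ b.verts, (D.num v : ℕ) :=
    Finset.sum_insert (b.notMem_verts_of_mem_edge hf hx)
  unfold edgeWeight at h1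
  unfold positionWeight
  omega

open Classical in
theorem deletedCount_face {x : V} (hx : x ∈ f) :
    D.deletedCount (b.face f hf x hx) + (if f ∈ D.T.edgeSet then 0 else 1) =
      D.deletedCount b := by
  have h : (b.face f hf x hx).edges = b.edges.erase f := rfl
  unfold deletedCount
  rw [h, Finset.filter_erase, Finset.card_erase_eq_ite]
  split_ifs with h1 h2 h2
  · exact absurd h2 (Finset.mem_filter.1 h1).2
  · exact Nat.sub_add_cancel (Finset.card_pos.2 ⟨f, h1⟩)
  · rfl
  · exact absurd (Finset.mem_filter.2 ⟨hf, h2⟩) h1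

/-- Replacing an edge of the tree by its initial vertex does not affect the other edges: a sibling
`v` of this vertex is not the initial vertex of an edge of the cell. -/
theorem respectful_face_iff (hfT : f ∈ D.T.edgeSet) {w v : V} (hne : s(w, v) ≠ f) :
    D.Respectful (b.face f hf (D.init f) (D.init_mem f)) w v ↔ D.Respectful b w v := by
  obtain ⟨p, q, rfl, hpq, -, hq⟩ := D.exists_parent_of_mem_edgeSet hfT
  constructor
  · rintro ⟨h1, h2, h3⟩
    exact ⟨(Finset.mem_erase.1 h1).2, h2, fun u hu => h3 u (Finset.mem_insert_of_mem hu)⟩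
  · rintro ⟨h1, h2, h3⟩
    refine ⟨Finset.mem_erase.2 ⟨hne, h1⟩, h2, fun u hu hu' => ?_⟩
    rcases Finset.mem_insert.1 hu with rfl | hu
    · rw [hq] at hu'
      obtain rfl := hu'.unique hpq
      exact absurd (b.disjoint_edges _ h1 _ hf w (Sym2.mem_mk_left _ _) (Sym2.mem_mk_left _ _)) hne
    · exact h3 u hu hu'

open Classical in
theorem disrespectfulCount_face (hfT : f ∈ D.T.edgeSet) :
    D.disrespectfulCount (b.face f hf (D.init f) (D.init_mem f)) +
      (if ∃ w v, f = s(w, v) ∧ D.Respectful b w v then 0 else 1) = D.disrespectfulCount b := by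
  unfold disrespectfulCount
  have h : (b.face f hf (D.init f) (D.init_mem f)).edges.filter (fun e => ¬ ∃ w v, e = s(w, v) ∧
      D.Respectful (b.face f hf (D.init f) (D.init_mem f)) w v) =
      (b.edges.filter fun e => ¬ ∃ w v, e = s(w, v) ∧ D.Respectful b w v).erase f := by
    rw [← Finset.filter_erase]
    refine Finset.filter_congr fun e he => not_congr (exists₂_congr fun w v => ?_)
    have hef : e ≠ f := (Finset.mem_erase.1 he).1
    exact and_congr_right fun h => respectful_face_iff hf hfT (h ▸ hef)
  rw [h, Finset.card_erase_eq_ite]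
  split_ifs with h1 h2 h2
  · exact absurd h2 (Finset.mem_filter.1 h1).2
  · exact Nat.sub_add_cancel (Finset.card_pos.2 ⟨f, h1⟩)
  · rfl
  · exact absurd (Finset.mem_filter.2 ⟨hf, h2⟩) h1

/-- If the smallest item of `b` is the edge `wv`, then the face in which this edge is replaced by
its initial vertex `v` is the most complex one. -/
theorem complexity_face_lt {w v : V} (h : D.MinEdge b w v) {x : V} (hx : x ∈ f)
    (hne : f ≠ s(w, v) ∨ x ≠ v) : D.complexity (b.face f hf x hx) <
      D.complexity (b.face s(w, v) h.1.1 v (Sym2.mem_mk_right w v)) := by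
  have hwv := h.1.2.1
  have hinit : D.init s(w, v) = v := D.init_mk hwv.lt.le
  have hT : s(w, v) ∈ D.T.edgeSet := hwv.adj
  have hp := positionWeight_face (D := D) h.1.1 (Sym2.mem_mk_right w v)
  have hd := deletedCount_face (D := D) h.1.1 (Sym2.mem_mk_right w v)
  have hr := disrespectfulCount_face (D := D) h.1.1 hT
  have he := edgeWeight_face (D := D) h.1.1 (Sym2.mem_mk_right w v)
  rw [if_pos ⟨w, v, rfl, h.1⟩] at hr
  simp only [hinit] at hp hr he
  rw [if_pos hT] at hd
  have hp' := positionWeight_face (D := D) hf hx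
  have hd' := deletedCount_face (D := D) hf hx
  have he' := edgeWeight_face (D := D) hf hx
  simp only [complexity, Prod.Lex.toLex_lt_toLex]
  rcases D.eq_init_or_term hx with hxi | hxt
  · right
    subst hxi
    have hne' : f ≠ s(w, v) := by
      rcases hne with h1 | h1
      · exact h1
      · rintro rfl
        exact h1 hinit
    refine ⟨by omega, ?_⟩
    by_cases hfT : f ∈ D.T.edgeSet
    · right
      have hr' := disrespectfulCount_face (D := D) hf hfT
      rw [if_pos hfT] at hd'
      refine ⟨by omega, ?_⟩
      by_cases hres : ∃ w v, f = s(w, v) ∧ D.Respectful b w v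
      · right
        rw [if_pos hres] at hr'
        refine ⟨by omega, ?_⟩
        obtain ⟨w', v', rfl, h'⟩ := hres
        have hi : D.init s(w', v') = v' := D.init_mk h'.2.1.lt.le
        have hle := h.2.2 w' v' h'
        have hvv : v ≠ v' := by
          rintro rfl
          exact hne' (b.disjoint_edges _ h'.1 _ h.1.1 v (Sym2.mem_mk_right _ _)
            (Sym2.mem_mk_right _ _))
        have hlt : D.num v < D.num v' := lt_of_le_of_ne hle fun h => hvv (D.num.injective h)
        simp only [hi] at he' ⊢
        have : (D.num v : ℕ) < D.num v' := hlt
        omega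
      · left
        rw [if_neg hres] at hr'
        omega
    · left
      rw [if_neg hfT] at hd'
      omega
  · left
    subst hxt
    have : (D.num (D.term f) : ℕ) < D.num (D.init f) := D.term_lt_init (b.edges_subset f hf)
    omega

end Faces

theorem exists_face_of_cellBoundary_ne_zero {b : Cell Γ n (i + 1)} {c : Cell Γ n i}
    (h : D.cellBoundary b c ≠ 0) : ∃ f hf x hx, c = b.face f hf x hx := by
  classical
  unfold cellBoundary at h
  rw [Finsupp.finsetSum_apply] at h
  obtain ⟨e, -, he⟩ := Finset.exists_ne_zero_of_sum_ne_zero h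
  by_contra hcon
  push Not at hcon
  apply he
  rw [Finsupp.smul_apply, Finsupp.sub_apply, Finsupp.single_eq_of_ne (hcon _ e.2 _ _),
    Finsupp.single_eq_of_ne (hcon _ e.2 _ _), sub_zero, smul_zero]

/-- The faces of a cell being distinct, their coefficients in its boundary are `±1`. -/
theorem cellBoundary_face_mul_self {b : Cell Γ n (i + 1)} {f : Sym2 V} (hf : f ∈ b.edges) :
    D.cellBoundary b (b.face f hf (D.init f) (D.init_mem f)) *
      D.cellBoundary b (b.face f hf (D.init f) (D.init_mem f)) = 1 := by
  classical
  have hne : ∀ (e : Sym2 V) (he : e ∈ b.edges) (x : V) (hx : x ∈ e), (e ≠ f ∨ x ≠ D.init f) →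
      b.face f hf (D.init f) (D.init_mem f) ≠ b.face e he x hx := by
    intro e he x hx h heq
    obtain ⟨h1, h2⟩ := b.eq_of_face_eq _ _ _ _ heq
    rcases h with h | h
    · exact h h1.symm
    · exact h h2.symm
  have key : D.cellBoundary b (b.face f hf (D.init f) (D.init_mem f)) =
      (-1 : ℤ) ^ (b.edges.filter fun e' => D.num (D.init e') ≤ D.num (D.init f)).card := by
    unfold cellBoundary
    rw [Finsupp.finsetSum_apply, Finset.sum_eq_single ⟨f, hf⟩]
    · have hlt := D.term_lt_init (b.edges_subset f hf)
      rw [Finsupp.smul_apply, Finsupp.sub_apply, Finsupp.single_eq_same,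
        Finsupp.single_eq_of_ne (hne f hf _ _ (Or.inr ?_)), sub_zero, smul_eq_mul, mul_one]
      intro h
      rw [h] at hlt
      exact lt_irrefl _ hlt
    · intro e _ hef
      have h1 : e.1 ≠ f := fun h => hef (Subtype.ext h)
      rw [Finsupp.smul_apply, Finsupp.sub_apply,
        Finsupp.single_eq_of_ne (hne _ e.2 _ _ (Or.inl h1)),
        Finsupp.single_eq_of_ne (hne _ e.2 _ _ (Or.inl h1)), sub_zero, smul_zero]
    · exact fun h => absurd (Finset.mem_attach _ _) h
  rw [key, ← mul_pow]
  simp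

theorem cellRewrite_of_collapsible {c : Cell Γ n i} (h : D.Collapsible c) :
    D.cellRewrite c = 0 := if_pos h

theorem cellRewrite_of_critical {c : Cell Γ n i} (h : D.Critical c) :
    D.cellRewrite c = Finsupp.single c 1 := by
  have h1 : D.W i c = none := not_not.1 h.1
  rw [cellRewrite, if_neg h.2, h1]

theorem cellRewrite_of_W_eq_some {c : Cell Γ n i} {b : Cell Γ n (i + 1)} (h : D.W i c = some b) :
    D.cellRewrite c = -(D.cellBoundary b c) • D.cellBoundary b + Finsupp.single c 1 := by
  rw [cellRewrite, if_neg (W_eq_some h).1, h]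

theorem complexity_lt_of_cellRewrite_ne_zero {c c' : Cell Γ n i} {b : Cell Γ n (i + 1)}
    (h : D.W i c = some b) (h' : D.cellRewrite c c' ≠ 0) : D.complexity c' < D.complexity c := by
  obtain ⟨w, v, hm, rfl⟩ := exists_minEdge_of_W_eq_some h
  have hinit : D.init s(w, v) = v := D.init_mk hm.1.2.1.lt.le
  rw [cellRewrite_of_W_eq_some h] at h'
  by_cases hcc : c' = b.face s(w, v) hm.1.1 v (Sym2.mem_mk_right w v)
  · exfalso
    apply h'
    have hsq := cellBoundary_face_mul_self (D := D) hm.1.1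
    simp only [hinit] at hsq
    rw [hcc, Finsupp.add_apply, Finsupp.smul_apply, Finsupp.single_eq_same, smul_eq_mul,
      neg_mul, hsq]
    norm_num
  · rw [Finsupp.add_apply, Finsupp.single_eq_of_ne hcc, add_zero, Finsupp.smul_apply,
      smul_eq_mul] at h'
    obtain ⟨f, hf, x, hx, rfl⟩ := exists_face_of_cellBoundary_ne_zero (right_ne_zero_of_mul h')
    refine complexity_face_lt hf hm hx ?_
    by_contra hcon
    push Not at hcon
    obtain ⟨rfl, rfl⟩ := hcon
    exact hcc rfl

theorem rewrite_single (c : Cell Γ n i) : D.rewrite i (Finsupp.single c 1) = D.cellRewrite c := by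
  rw [rewrite, Finsupp.linearCombination_single, one_smul]

theorem rewrite_of_critical {x : Cell Γ n i →₀ ℤ}
    (hx : x ∈ Finsupp.supported ℤ ℤ {c : Cell Γ n i | D.Critical c}) : D.rewrite i x = x := by
  rw [rewrite, Finsupp.linearCombination_apply]
  conv_rhs => rw [← Finsupp.sum_single x]
  refine Finsupp.sum_congr fun c hc => ?_
  rw [cellRewrite_of_critical (hx hc), Finsupp.smul_single_one]

theorem pow_rewrite_mem_of_le {x : Cell Γ n i →₀ ℤ} {m k : ℕ} (hmk : m ≤ k)
    (hx : (D.rewrite i ^ m) x ∈ Finsupp.supported ℤ ℤ {c : Cell Γ n i | D.Critical c}) :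
    (D.rewrite i ^ k) x ∈ Finsupp.supported ℤ ℤ {c : Cell Γ n i | D.Critical c} := by
  induction k, hmk using Nat.le_induction with
  | base => exact hx
  | succ k _ ih => rwa [pow_succ', Module.End.mul_apply, rewrite_of_critical ih]

variable (D) in
/-- The chains that some power of `R` maps to combinations of critical cells. -/
def eventuallyCritical (i : ℕ) : Submodule ℤ (Cell Γ n i →₀ ℤ) where
  carrier := {x | ∃ m, (D.rewrite i ^ m) x ∈
    Finsupp.supported ℤ ℤ {c : Cell Γ n i | D.Critical c}}
  add_mem' := by
    rintro x y ⟨m, hm⟩ ⟨k, hk⟩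
    refine ⟨max m k, ?_⟩
    rw [map_add]
    exact add_mem (pow_rewrite_mem_of_le (le_max_left _ _) hm)
      (pow_rewrite_mem_of_le (le_max_right _ _) hk)
  zero_mem' := ⟨0, by simp⟩
  smul_mem' := by
    rintro a x ⟨m, hm⟩
    exact ⟨m, by rw [map_smul]; exact Submodule.smul_mem _ _ hm⟩

theorem eventuallyCritical_eq_top : D.eventuallyCritical i = ⊤ := by
  have hR : ∀ x, D.rewrite i x ∈ D.eventuallyCritical i → x ∈ D.eventuallyCritical i := by
    rintro x ⟨m, hm⟩
    exact ⟨m + 1, by rwa [pow_succ, Module.End.mul_apply]⟩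
  have hsum : ∀ x : Cell Γ n i →₀ ℤ, (∀ c, x c ≠ 0 →
      Finsupp.single c 1 ∈ D.eventuallyCritical i) → x ∈ D.eventuallyCritical i := by
    intro x hx
    rw [← Finsupp.sum_single x]
    refine Submodule.sum_mem _ fun c hc => ?_
    rw [← Finsupp.smul_single_one]
    exact Submodule.smul_mem _ _ (hx c (Finsupp.mem_support_iff.1 hc))
  have key : ∀ c : Cell Γ n i, Finsupp.single c 1 ∈ D.eventuallyCritical i := by
    intro c
    induction hc : D.complexity c using WellFoundedLT.induction generalizing c with
    | _ k ih =>
    by_cases hcol : D.Collapsible c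
    · apply hR
      rw [rewrite_single, cellRewrite_of_collapsible hcol]
      exact zero_mem _
    rcases hW : D.W i c with _ | b
    · refine ⟨0, ?_⟩
      rw [pow_zero, Module.End.one_apply]
      exact Finsupp.single_mem_supported ℤ 1 ⟨not_not.2 hW, hcol⟩
    · apply hR
      rw [rewrite_single]
      exact hsum _ fun c' hc' =>
        ih _ (hc ▸ complexity_lt_of_cellRewrite_ne_zero hW hc') c' rfl
  exact eq_top_iff.2 fun x _ => hsum x fun c _ => key c

variable (D) in
theorem exists_pow_rewrite_critical (i : ℕ) : ∃ m, ∀ x,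
    (D.rewrite i ^ m) x ∈ Finsupp.supported ℤ ℤ {c : Cell Γ n i | D.Critical c} := by
  have h : ∀ c : Cell Γ n i, ∃ m, (D.rewrite i ^ m) (Finsupp.single c 1) ∈
      Finsupp.supported ℤ ℤ {c : Cell Γ n i | D.Critical c} := by
    intro c
    have : Finsupp.single c 1 ∈ D.eventuallyCritical i := by
      rw [eventuallyCritical_eq_top]; trivial
    exact this
  choose m hm using h
  obtain ⟨M, hM⟩ := (Set.finite_range m).bddAbove
  refine ⟨M, fun x => ?_⟩
  rw [← Finsupp.sum_single x, Finsupp.sum, map_sum]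
  refine Submodule.sum_mem _ fun c _ => ?_
  rw [← Finsupp.smul_single_one, map_smul]
  exact Submodule.smul_mem _ _ (pow_rewrite_mem_of_le (hM ⟨c, rfl⟩) (hm c))

variable (D) in
theorem rewritingStabilizes : D.RewritingStabilizes := by
  intro i
  obtain ⟨m, hm⟩ := D.exists_pow_rewrite_critical i
  have hstab : D.rewrite i ^ m = D.rewrite i ^ (m + 1) := by
    refine LinearMap.ext fun x => ?_
    rw [pow_succ', Module.End.mul_apply, rewrite_of_critical (hm x)]
  refine ⟨⟨m, hstab⟩, fun x c hc => ?_⟩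
  have hne : {m : ℕ | D.rewrite i ^ m = D.rewrite i ^ (m + 1)}.Nonempty := ⟨m, hstab⟩
  have h0 := Nat.sInf_mem hne
  set m₀ := sInf {m : ℕ | D.rewrite i ^ m = D.rewrite i ^ (m + 1)}
  have hall : ∀ k, m₀ ≤ k → D.rewrite i ^ k = D.rewrite i ^ m₀ := by
    intro k hk
    induction k, hk using Nat.le_induction with
    | base => rfl
    | succ k _ ih => rw [pow_succ, ih, ← pow_succ]; exact h0.symm
  have hx := hm x
  rw [hall m (Nat.sInf_le hstab)] at hx
  exact hx hc

/-- A linear functional that is unchanged by `R` is unchanged by the stable power of `R`. -/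
theorem apply_stableRewrite {N : Type*} [AddCommGroup N] (φ : (Cell Γ n i →₀ ℤ) →ₗ[ℤ] N)
    (h : ∀ x, φ (D.rewrite i x) = φ x) (x : Cell Γ n i →₀ ℤ) :
    φ (D.stableRewrite i x) = φ x := by
  unfold stableRewrite
  induction sInf {m : ℕ | D.rewrite i ^ m = D.rewrite i ^ (m + 1)} with
  | zero => rfl
  | succ m ih => rw [pow_succ', Module.End.mul_apply, h, ih]

end OrderedTree

/-! ### The type of a cell: its edges and the distribution of its vertices -/

theorem SufficientlySubdivided.le_length {V : Type*} [Fintype V] {n : ℕ} {G : SimpleGraph V}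
    (h : SufficientlySubdivided n G) {a b : V} (p : G.Walk a b) (hab : a ≠ b)
    (ha : valency G a ≠ 2) (hb : valency G b ≠ 2) : n ≤ p.length + 1 := by
  classical
  have h1 := h.path_length a b p.bypass p.bypass_isPath hab ha hb
  have h2 := p.length_bypass_le_length
  omega

theorem valency_mono {V : Type*} [Finite V] {G H : SimpleGraph V} (h : G ≤ H) (v : V) :
    valency G v ≤ valency H v :=
  Set.ncard_le_ncard (fun _ hx => h hx) (Set.toFinite _)

namespace OrderedTree

variable {V : Type u} [Fintype V] {Γ : SimpleGraph V} {n i : ℕ} (D : OrderedTree Γ n)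

/-- The tree `T` without the edges that meet an edge of `E`. -/
def avoiding (E : Finset (Sym2 V)) : SimpleGraph V where
  Adj a b := D.T.Adj a b ∧ (∀ e ∈ E, a ∉ e) ∧ ∀ e ∈ E, b ∉ e
  symm := ⟨fun _ _ h => ⟨h.1.symm, h.2.2, h.2.1⟩⟩
  loopless := ⟨fun _ h => h.1.ne rfl⟩

/-- `w` is the parent of `v`, and neither of them is an end of an edge of `E`. -/
def ParentAvoiding (E : Finset (Sym2 V)) (w v : V) : Prop :=
  D.Parent w v ∧ (∀ e ∈ E, w ∉ e) ∧ ∀ e ∈ E, v ∉ e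

/-- The number of vertices of `c` in the component of `x` of the tree minus the edges of `c`. -/
noncomputable def load (c : Cell Γ n i) (x : V) : ℕ :=
  {v | v ∈ c.verts ∧ (D.avoiding c.edges).Reachable x v}.ncard

/-- Two cells have the same type when they have the same edges, and equally many vertices in each
component of the tree minus these edges. -/
def SameType (c c' : Cell Γ n i) : Prop := c.edges = c'.edges ∧ ∀ x, D.load c x = D.load c' x

/-- The tree `T` cuts the circles of `Γ` well: each end of an edge `uv` outside `T` has valency
`≠ 2` in `Γ` or in `T`, and the interior vertices of the path of `T` from `u` to `v` have valency 2
in `Γ` and no neighbours outside this path. -/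
structure CutsWell : Prop where
  valency_ne : ∀ u v, Γ.Adj u v → ¬ D.T.Adj u v → valency Γ u ≠ 2 ∨ valency D.T u ≠ 2
  exists_walk : ∀ u v, Γ.Adj u v → ¬ D.T.Adj u v → ∃ q : D.T.Walk u v, ∀ z ∈ q.support,
    z ≠ u → z ≠ v → valency Γ z = 2 ∧ ∀ t, Γ.Adj z t → D.T.Adj z t ∧ t ∈ q.support

variable {D}

theorem descendant_of_parentAvoiding {E : Finset (Sym2 V)} {a b : V}
    (h : Relation.ReflTransGen (D.ParentAvoiding E) a b) :
    Relation.ReflTransGen D.Parent a b := h.lift id fun _ _ h => h.1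

/-- A vertex whose parent is outside its component is an ancestor of the whole component. -/
theorem ancestor_of_reachable {E : Finset (Sym2 V)} {a b : V}
    (ha : ∀ p, ¬ D.ParentAvoiding E p a) (h : (D.avoiding E).Reachable a b) :
    Relation.ReflTransGen (D.ParentAvoiding E) a b := by
  rw [SimpleGraph.reachable_iff_reflTransGen] at h
  induction h with
  | refl => exact .refl
  | @tail b b' _ hbb ih =>
    rcases parent_or_parent hbb.1 with h1 | h1
    · exact ih.tail ⟨h1, hbb.2.1, hbb.2.2⟩
    · have h2 : D.ParentAvoiding E b' b := ⟨h1, hbb.2.2, hbb.2.1⟩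
      rcases ih.cases_tail with h3 | ⟨p, h3, h4⟩
      · exact absurd (h3 ▸ h2) (ha b')
      · rwa [h4.1.unique h1] at h3

theorem reachable_of_walk {E : Finset (Sym2 V)} {u v : V} (q : D.T.Walk u v)
    (h : ∀ z ∈ q.support, ∀ e ∈ E, z ∉ e) : (D.avoiding E).Reachable u v := by
  induction q with
  | nil => exact SimpleGraph.Reachable.refl _
  | @cons a b d hab q ih =>
    have hadj : (D.avoiding E).Adj a b := ⟨hab, h a (by simp), h b (by simp)⟩
    exact hadj.reachable.trans (ih fun z hz => h z (by simp [hz]))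

variable (D) in
open Classical in
/-- The cochain that takes the value 1 on the cells of the type of `c`, and 0 on all others. -/
noncomputable def typeCochain (c : Cell Γ n i) : (Cell Γ n i →₀ ℤ) →ₗ[ℤ] ℤ :=
  Finsupp.linearCombination ℤ fun c' => if D.SameType c c' then 1 else 0

open Classical in
theorem typeCochain_single (c c' : Cell Γ n i) :
    D.typeCochain c (Finsupp.single c' 1) = if D.SameType c c' then 1 else 0 := by
  rw [typeCochain, Finsupp.linearCombination_single, one_smul]

variable [DecidableEq V]

theorem Critical.occupied_parent {c : Cell Γ n i} (hc : D.Critical c) {p v : V} (hv : v ∈ c.verts)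
    (hp : D.Parent p v) : c.Occupied p := by
  by_contra h
  exact hc.not_unblockedVia p v ⟨hv, hp.1, hp.2, h⟩

theorem Critical.exists_smaller_sibling {c : Cell Γ n i} (hc : D.Critical c) {w v : V}
    (he : s(w, v) ∈ c.edges) (hp : D.Parent w v) :
    ∃ u ∈ c.verts, D.Parent w u ∧ D.num u < D.num v := by
  by_contra hcon
  push Not at hcon
  refine hc.not_respectful w v ⟨he, hp, fun u hu hu' => lt_of_le_of_ne (hcon u hu hu') ?_⟩
  intro h
  rw [D.num.injective h] at he
  exact c.notMem_verts_of_mem_edge he (Sym2.mem_mk_right _ _) hu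

theorem Critical.mem_of_ancestor {c : Cell Γ n i} (hc : D.Critical c) {a b : V}
    (h : Relation.ReflTransGen (D.ParentAvoiding c.edges) a b) (hb : b ∈ c.verts) :
    a ∈ c.verts := by
  induction h using Relation.ReflTransGen.head_induction_on with
  | refl => exact hb
  | head h1 _ ih =>
    rcases hc.occupied_parent ih h1.1 with h2 | ⟨e, he, h2⟩
    · exact h2
    · exact absurd h2 (h1.2.1 e he)

/-- The vertices of a critical cell between a vertex `m` and the topmost vertex `r` of its
component form a path. -/
theorem Critical.exists_stack {c : Cell Γ n i} (hc : D.Critical c) {m : V} (hm : m ∈ c.verts) :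
    ∃ (r : V) (p : D.T.Walk r m) (S : Finset V), S ⊆ c.verts ∧ S.card = p.length + 1 ∧
      (∀ s ∈ S, D.num r ≤ D.num s ∧ D.num s ≤ D.num m) ∧ D.num r ≤ D.num m ∧
      ∀ q, D.Parent q r → ∃ e ∈ c.edges, q ∈ e := by
  induction hk : D.num m using WellFoundedLT.induction generalizing m with
  | _ k ih =>
  subst hk
  by_cases hpar : ∃ q, D.Parent q m ∧ q ∈ c.verts
  · obtain ⟨q, hq, hqc⟩ := hpar
    obtain ⟨r, p, S, hS, hcard, hbd, hrq, hr⟩ := ih _ hq.lt hqc rfl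
    refine ⟨r, p.concat hq.adj, insert m S, ?_, ?_, ?_, hrq.trans hq.lt.le, hr⟩
    · exact Finset.insert_subset hm hS
    · rw [Finset.card_insert_of_notMem, hcard, SimpleGraph.Walk.length_concat]
      exact fun h => not_le.2 hq.lt (hbd m h).2
    · intro s hs
      rcases Finset.mem_insert.1 hs with rfl | hs
      · exact ⟨hrq.trans hq.lt.le, le_rfl⟩
      · exact ⟨(hbd s hs).1, (hbd s hs).2.trans hq.lt.le⟩
  · refine ⟨m, .nil, {m}, by simpa using hm, rfl, by simp, le_rfl, fun q hq => ?_⟩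
    rcases hc.occupied_parent hm hq with h | h
    · exact absurd ⟨q, hq, h⟩ hpar
    · exact h

/-- In a critical cell no vertices are stacked beyond a branching vertex of the tree: the base
vertex, the essential vertices of the edges and the branching vertices are so far from one another
that all vertices of the cell find room before the next branching vertex. -/
theorem Critical.eq_of_parent {c : Cell Γ n i} (hc : D.Critical c) (hD : D.CutsWell)
    (hΓ : SufficientlySubdivided n Γ) {m x y : V} (hm : m ∈ c.verts) (hx : x ∈ c.verts)
    (hmx : D.Parent m x) (hmy : D.Parent m y) : y = x := by
  by_contra hne
  have hm3 := D.three_le_valency hmx hmy (Ne.symm hne)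
  have hm3' := hm3.trans (valency_mono D.le m)
  have hlen : ∀ {z : V} (p : D.T.Walk z m), z ≠ m → (valency Γ z ≠ 2 ∨ valency D.T z ≠ 2) →
      n ≤ p.length + 1 := by
    rintro z p hz (h | h)
    · have := hΓ.le_length (p.mapLe D.le) hz h (by omega)
      rwa [SimpleGraph.Walk.length_map] at this
    · exact D.subdivided.le_length p hz h (by omega)
  obtain ⟨r, p, S, hS, hcard, hbd, hrm, hr⟩ := hc.exists_stack hm
  have hxS : x ∉ S := fun h => not_le.2 hmx.lt (hbd x h).2
  have hS' : insert x S ⊆ c.verts := Finset.insert_subset hx hS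
  have h1 := Finset.card_le_card hS'
  rw [Finset.card_insert_of_notMem hxS, hcard] at h1
  have h2 := c.card_total
  by_cases hroot : r = D.root
  · have hv : valency D.T r = 1 := by rw [hroot]; exact D.valency_root
    have h3 := hlen p (by rintro rfl; omega) (Or.inr (by omega))
    omega
  obtain ⟨q, hq⟩ := D.exists_parent hroot
  obtain ⟨e, he, hqe⟩ := hr q hq
  have hepos : 0 < c.edges.card := Finset.card_pos.2 ⟨e, he⟩
  have hnm : ∀ z ∈ e, z ≠ m := by
    rintro z hz rfl
    exact c.notMem_verts_of_mem_edge he hz hm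
  have hq2 : ¬ (valency Γ q ≠ 2 ∨ valency D.T q ≠ 2) := by
    intro h
    have h3 := hlen (.cons hq.adj p) (hnm q hqe) h
    rw [SimpleGraph.Walk.length_cons] at h3
    omega
  by_cases heT : e ∈ D.T.edgeSet
  · obtain ⟨w, v, rfl, hwv, -, -⟩ := D.exists_parent_of_mem_edgeSet heT
    obtain ⟨u, hu, hwu, huv⟩ := hc.exists_smaller_sibling he hwv
    have hw3 := D.three_le_valency hwu hwv (fun h => huv.ne (congrArg D.num h))
    rcases Sym2.mem_iff.1 hqe with rfl | rfl
    · exact hq2 (Or.inr (by omega))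
    · have h3 := hlen (.cons hwv.adj (.cons hq.adj p)) (hnm w (Sym2.mem_mk_left _ _))
        (Or.inr (by omega))
      rw [SimpleGraph.Walk.length_cons, SimpleGraph.Walk.length_cons] at h3
      -- the vertex `u`, which makes the edge disrespectful, lies outside the stack
      have hur := huv.trans hq.lt
      have huS : u ∉ insert x S := by
        intro h
        rcases Finset.mem_insert.1 h with rfl | h
        · exact lt_asymm hur (hrm.trans_lt hmx.lt)
        · exact not_le.2 hur (hbd u h).1
      have h4 := Finset.card_le_card (Finset.insert_subset hu hS')
      rw [Finset.card_insert_of_notMem huS, Finset.card_insert_of_notMem hxS, hcard] at h4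
      omega
  · obtain ⟨z, rfl⟩ := hqe
    exact hq2 (hD.valency_ne q z (c.edges_subset _ he) heT)

/-- In a critical cell every vertex lies on one line with the other points of its component. -/
theorem Critical.comparable {c : Cell Γ n i} (hc : D.Critical c) (hD : D.CutsWell)
    (hΓ : SufficientlySubdivided n Γ) {a b : V} (ha : a ∈ c.verts)
    (h : (D.avoiding c.edges).Reachable a b) :
    Relation.ReflTransGen (D.ParentAvoiding c.edges) a b ∨
      Relation.ReflTransGen (D.ParentAvoiding c.edges) b a := by
  induction hk : D.num a using WellFoundedLT.induction generalizing a with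
  | _ k ih =>
  subst hk
  by_cases hpar : ∃ p, D.ParentAvoiding c.edges p a
  · obtain ⟨p, hp⟩ := hpar
    have hpc : p ∈ c.verts := hc.mem_of_ancestor (.single hp) ha
    have hadj : (D.avoiding c.edges).Adj p a := ⟨hp.1.1, hp.2⟩
    rcases ih _ hp.1.lt hpc (hadj.reachable.trans h) rfl with h1 | h1
    · rcases h1.cases_head with rfl | ⟨y, hy, h2⟩
      · exact Or.inr (.single hp)
      · rw [hc.eq_of_parent hD hΓ hpc ha hp.1 hy.1] at h2
        exact Or.inl h2
    · exact Or.inr (h1.tail hp)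
  · exact Or.inl (ancestor_of_reachable (not_exists.1 hpar) h)

theorem exists_reachable_of_load_eq {c c' : Cell Γ n i} (h : D.SameType c c') {a : V}
    (ha : a ∈ c.verts) (ha' : a ∉ c'.verts) :
    ∃ b ∈ c'.verts, b ∉ c.verts ∧ (D.avoiding c.edges).Reachable a b := by
  by_contra hcon
  push Not at hcon
  have h1 := h.2 a
  unfold load at h1
  rw [← h.1] at h1
  refine absurd h1 (ne_of_gt (Set.ncard_lt_ncard ⟨fun b hb => ⟨?_, hb.2⟩, fun hsub => ?_⟩
    (Set.toFinite _)))
  · by_contra hbc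
    exact hcon b hb.1 hbc hb.2
  · exact ha' (hsub ⟨ha, SimpleGraph.Reachable.refl a⟩).1

/-- Critical cells are determined by their types. -/
theorem Critical.eq_of_sameType {c c' : Cell Γ n i} (hc : D.Critical c) (hc' : D.Critical c')
    (hD : D.CutsWell) (hΓ : SufficientlySubdivided n Γ) (h : D.SameType c c') : c = c' := by
  have hsub : c.verts ⊆ c'.verts := by
    intro a ha
    by_contra ha'
    obtain ⟨b, hb', hb, hab⟩ := exists_reachable_of_load_eq h ha ha'
    rcases hc.comparable hD hΓ ha hab with h1 | h1
    · rw [h.1] at h1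
      exact ha' (hc'.mem_of_ancestor h1 hb')
    · exact hb (hc.mem_of_ancestor h1 ha)
  have h1 := c.card_total
  have h2 := c'.card_total
  rw [c.card_edges] at h1
  rw [c'.card_edges] at h2
  ext1
  · exact Finset.eq_of_subset_of_card_le hsub (by omega)
  · exact h.1

/-- A collapsible cell does not have the type of a critical cell. If `w-v` is its smallest item,
then the critical cell has a vertex at a smaller child `u` of `w`; hence the collapsible cell has a
vertex in the branch at `u`, and the smallest such vertex is unblocked or makes `w-v`
disrespectful. -/
theorem Critical.not_collapsible_of_sameType {c c' : Cell Γ n i} (hc : D.Critical c)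
    (h : D.SameType c c') : ¬ D.Collapsible c' := by
  intro hcol
  obtain ⟨w, v, hmin⟩ := collapsible_iff.1 hcol
  obtain ⟨he, hwv, hresp⟩ := hmin.1
  have hec : s(w, v) ∈ c.edges := by rw [h.1]; exact he
  obtain ⟨u, hu, hwu, huv⟩ := hc.exists_smaller_sibling hec hwv
  have hur : ∀ p, ¬ D.ParentAvoiding c.edges p u := by
    intro p hp
    rw [hp.1.unique hwu] at hp
    exact hp.2.1 _ hec (Sym2.mem_mk_left w v)
  have hpos : 0 < D.load c' u := by
    rw [← h.2 u]
    exact (Set.ncard_pos (Set.toFinite _)).2 ⟨u, hu, SimpleGraph.Reachable.refl u⟩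
  obtain ⟨x, hx, hxmin⟩ := Set.exists_min_image _ D.num (Set.toFinite _)
    ((Set.ncard_pos (Set.toFinite _)).1 hpos)
  rw [Set.mem_ofPred, ← h.1] at hx
  have hdesc := ancestor_of_reachable hur hx.2
  rcases hdesc.cases_tail with rfl | ⟨p, hup, hpx⟩
  · exact lt_asymm huv (hresp _ hx.1 hwu)
  · have hreach : (D.avoiding c.edges).Reachable u p := by
      have hadj : (D.avoiding c.edges).Adj x p := ⟨hpx.1.1.symm, hpx.2.2, hpx.2.1⟩
      exact hx.2.trans hadj.reachable
    have hunb : D.UnblockedVia c' p x := by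
      refine ⟨hx.1, hpx.1.1, hpx.1.2, ?_⟩
      rintro (hp | ⟨e, he', hp⟩)
      · refine not_le.2 hpx.1.lt (hxmin p ⟨hp, ?_⟩)
        rwa [← h.1]
      · exact hpx.2.1 e (h.1 ▸ he') hp
    exact lt_asymm (hmin.2.1 p x hunb)
      (descendant_lt_sibling hwu hwv huv (descendant_of_parentAvoiding hdesc))

/-! ### The cocycle of a critical cell -/

/-- The ends of an edge that is disjoint from the edges of a critical cell lie in the same component
of the tree minus the latter edges. -/
theorem Critical.reachable_of_disjoint {c : Cell Γ n i} (hc : D.Critical c) (hD : D.CutsWell)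
    {u v : V} (huv : Γ.Adj u v) (hu : ∀ e ∈ c.edges, u ∉ e) (hv : ∀ e ∈ c.edges, v ∉ e) :
    (D.avoiding c.edges).Reachable u v := by
  by_cases hT : D.T.Adj u v
  · exact SimpleGraph.Adj.reachable (show (D.avoiding c.edges).Adj u v from ⟨hT, hu, hv⟩)
  obtain ⟨q, hq⟩ := hD.exists_walk u v huv hT
  have key : ∀ z ∈ q.support, ∀ e ∈ c.edges, z ∉ e := by
    intro z hz e he hze
    have hne : ∀ t ∈ e, t ≠ u ∧ t ≠ v := fun t ht =>
      ⟨by rintro rfl; exact hu e he ht, by rintro rfl; exact hv e he ht⟩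
    have hzz := hq z hz (hne z hze).1 (hne z hze).2
    have hval : ∀ t ∈ e, valency Γ t = 2 := by
      intro t ht
      by_cases htz : t = z
      · rw [htz]; exact hzz.1
      have hezt : e = s(z, t) := (Sym2.mem_and_mem_iff (Ne.symm htz)).1 ⟨hze, ht⟩
      have hadj : Γ.Adj z t := c.edges_subset _ (hezt ▸ he)
      exact (hq t (hzz.2 t hadj).2 (hne t ht).1 (hne t ht).2).1
    have heT : e ∈ D.T.edgeSet := by
      obtain ⟨t, rfl⟩ := hze
      exact (hzz.2 t (c.edges_subset _ he)).1
    obtain ⟨w, x, rfl, hwx, -, -⟩ := D.exists_parent_of_mem_edgeSet heT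
    obtain ⟨y, -, hwy, hyx⟩ := hc.exists_smaller_sibling he hwx
    have h3 := D.three_le_valency hwy hwx (fun h => hyx.ne (congrArg D.num h))
    have h4 := valency_mono D.le w
    have h5 := hval w (Sym2.mem_mk_left _ _)
    omega
  exact reachable_of_walk q key

/-- Moving a point across an edge that is disjoint from the edges of a critical cell `c` does not
affect whether a cell has the type of `c`. -/
theorem Critical.sameType_face {c : Cell Γ n i} (hc : D.Critical c) (hD : D.CutsWell)
    {b : Cell Γ n (i + 1)} {f : Sym2 V} (hf : f ∈ b.edges) {x y : V} (hx : x ∈ f) (hy : y ∈ f)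
    (h : D.SameType c (b.face f hf x hx)) : D.SameType c (b.face f hf y hy) := by
  by_cases hxy : x = y
  · subst hxy; exact h
  refine ⟨h.1, fun z => ?_⟩
  have hE : c.edges = b.edges.erase f := h.1
  have hfree : ∀ t ∈ f, ∀ e ∈ c.edges, t ∉ e := by
    intro t ht e he hte
    rw [hE, Finset.mem_erase] at he
    exact he.1 (b.disjoint_edges e he.2 f hf t hte ht)
  have hfxy : f = s(x, y) := (Sym2.mem_and_mem_iff hxy).1 ⟨hx, hy⟩
  have hadj : Γ.Adj x y := b.edges_subset _ (hfxy ▸ hf)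
  have hreach := hc.reachable_of_disjoint hD hadj (hfree x hx) (hfree y hy)
  rw [h.2 z]
  have hload : ∀ {t : V} (ht : t ∈ f), D.load (b.face f hf t ht) z =
      {v | v = t ∧ (D.avoiding c.edges).Reachable z t}.ncard +
        {v | v ∈ b.verts ∧ (D.avoiding c.edges).Reachable z v}.ncard := by
    intro t ht
    rw [← Set.ncard_union_eq _ (Set.toFinite _) (Set.toFinite _)]
    · unfold load
      congr 1
      ext v
      rw [Set.mem_ofPred, hE]
      change v ∈ insert t b.verts ∧ (D.avoiding (b.edges.erase f)).Reachable z v ↔ _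
      rw [Finset.mem_insert]
      constructor
      · rintro ⟨rfl | h1, h2⟩
        · exact Or.inl ⟨rfl, h2⟩
        · exact Or.inr ⟨h1, h2⟩
      · rintro (⟨rfl, h2⟩ | ⟨h1, h2⟩)
        · exact ⟨Or.inl rfl, h2⟩
        · exact ⟨Or.inr h1, h2⟩
    · rw [Set.disjoint_left]
      rintro v ⟨rfl, -⟩ ⟨h1, -⟩
      exact b.notMem_verts_of_mem_edge hf ht h1
  rw [hload hx, hload hy]
  by_cases hz : (D.avoiding c.edges).Reachable z x
  · simp [hz, hz.trans hreach]
  · have hz' : ¬ (D.avoiding c.edges).Reachable z y := fun h1 => hz (h1.trans hreach.symm)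
    simp [hz, hz']

theorem Critical.typeCochain_cellBoundary {c : Cell Γ n i} (hc : D.Critical c) (hD : D.CutsWell)
    (b : Cell Γ n (i + 1)) : D.typeCochain c (D.cellBoundary b) = 0 := by
  classical
  rw [cellBoundary, map_sum]
  refine Finset.sum_eq_zero fun e _ => ?_
  rw [map_smul, map_sub, typeCochain_single, typeCochain_single,
    if_congr ⟨hc.sameType_face hD e.2 _ (D.term_mem _), hc.sameType_face hD e.2 _ (D.init_mem _)⟩
      rfl rfl, sub_self, smul_zero]

theorem Critical.typeCochain_boundary {c : Cell Γ n i} (hc : D.Critical c) (hD : D.CutsWell)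
    (x : Cell Γ n (i + 1) →₀ ℤ) : D.typeCochain c (D.boundary i x) = 0 := by
  rw [boundary, Finsupp.linearCombination_apply, Finsupp.sum, map_sum]
  exact Finset.sum_eq_zero fun b _ => by rw [map_smul, hc.typeCochain_cellBoundary hD, smul_zero]

theorem Critical.typeCochain_rewrite {c : Cell Γ n i} (hc : D.Critical c) (hD : D.CutsWell)
    (x : Cell Γ n i →₀ ℤ) : D.typeCochain c (D.rewrite i x) = D.typeCochain c x := by
  suffices h : (D.typeCochain c).comp (D.rewrite i) = D.typeCochain c from
    LinearMap.congr_fun h x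
  refine Finsupp.lhom_ext' fun c' => LinearMap.ext_ring ?_
  rw [LinearMap.comp_apply, LinearMap.comp_apply, LinearMap.comp_apply, Finsupp.lsingle_apply,
    rewrite_single]
  by_cases hcol : D.Collapsible c'
  · rw [cellRewrite_of_collapsible hcol, map_zero, typeCochain_single,
      if_neg fun h => hc.not_collapsible_of_sameType h hcol]
  rcases hW : D.W i c' with _ | b
  · rw [cellRewrite_of_critical ⟨not_not.2 hW, hcol⟩]
  · rw [cellRewrite_of_W_eq_some hW, map_add, map_smul, hc.typeCochain_cellBoundary hD, smul_zero,
      zero_add]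

theorem Critical.typeCochain_eq_apply {c : Cell Γ n i} (hc : D.Critical c) (hD : D.CutsWell)
    (hΓ : SufficientlySubdivided n Γ) {x : Cell Γ n i →₀ ℤ}
    (hx : ∀ c' ∈ x.support, D.Critical c') : D.typeCochain c x = x c := by
  classical
  rw [typeCochain, Finsupp.linearCombination_apply, Finsupp.sum, Finset.sum_eq_single c]
  · rw [if_pos ⟨rfl, fun _ => rfl⟩, smul_eq_mul, mul_one]
  · intro c' hc' hne
    rw [if_neg fun h => hne (hc.eq_of_sameType (hx c' hc') hD hΓ h).symm, smul_zero]
  · intro h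
    rw [Finsupp.notMem_support_iff.1 h, zero_smul]

/-! ### The homology of the Morse complex -/

theorem morseBoundary_eq_zero (hD : D.CutsWell) (hΓ : SufficientlySubdivided n Γ) (i : ℕ) :
    D.morseBoundary i = 0 := by
  refine LinearMap.ext fun y => Finsupp.ext fun ⟨c, hc⟩ => ?_
  set x := D.boundary i (Finsupp.lmapDomain ℤ ℤ Subtype.val y) with hx
  change D.stableRewrite i x c = 0
  rw [← hc.typeCochain_eq_apply hD hΓ ((D.rewritingStabilizes i).2 x),
    apply_stableRewrite _ (hc.typeCochain_rewrite hD), hx, hc.typeCochain_boundary hD]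

/-- The homology of a Morse complex without boundary maps. -/
theorem exists_homology_iso (hd : ∀ i, (D.morseBoundary i).comp (D.morseBoundary (i + 1)) = 0)
    (h0 : ∀ i, D.morseBoundary i = 0) :
    (∀ i j : ℕ, (D.morseComplex hd).d i j = 0) ∧
      ∀ i : ℕ, ∃ φ : (D.morseComplex hd).homology i ≅
          ModuleCat.of ℤ ({c : Cell Γ n i // D.Critical c} →₀ ℤ),
        (D.morseComplex hd).homologyπ i ≫ φ.hom = (D.morseComplex hd).iCycles i := by
  have hzero : ∀ i j : ℕ, (D.morseComplex hd).d i j = 0 := by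
    intro i j
    by_cases hij : j + 1 = i
    · subst hij
      have h := ChainComplex.of_d (fun i => ModuleCat.of ℤ (D.MorseChains i))
        (fun i => ModuleCat.ofHom (D.morseBoundary i)) j
      rw [h0, ModuleCat.ofHom_zero] at h
      exact h
    · exact (D.morseComplex hd).shape _ _ hij
  refine ⟨hzero, fun i => ?_⟩
  have h1 := (D.morseComplex hd).isIso_homologyπ _ i rfl (hzero _ _)
  have h2 := (D.morseComplex hd).isIso_iCycles i _ rfl (hzero _ _)
  exact ⟨(@asIso _ _ _ _ _ h1).symm ≪≫ @asIso _ _ _ _ _ h2,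
    IsIso.hom_inv_id_assoc ((D.morseComplex hd).homologyπ i) _⟩

end OrderedTree

/-! ### A maximal tree that cuts every circle at its essential vertex -/

section CuttingTree

variable {V : Type*} {Γ : SimpleGraph V}

theorem exists_adj_of_mem_cycle {a z : V} {p : Γ.Walk a a} (hp : p.IsCycle) (hz : z ∈ p.support) :
    ∃ t, s(z, t) ∈ p.edges := by
  have h1 := hp.ncard_neighborSet_toSubgraph_eq_two hz
  obtain ⟨t, ht⟩ := Set.nonempty_of_ncard_ne_zero (by rw [h1]; exact two_ne_zero)
  exact ⟨t, (SimpleGraph.Walk.mem_edges_toSubgraph p).1 (SimpleGraph.Subgraph.mem_edgeSet.2 ht)⟩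

/-- A vertex of valency 2 on a circle has no edges outside the circle. -/
theorem mem_edges_of_mem_cycle [Finite V] {a z t : V} {p : Γ.Walk a a} (hp : p.IsCycle)
    (hz : z ∈ p.support) (hval : valency Γ z = 2) (hadj : Γ.Adj z t) : s(z, t) ∈ p.edges := by
  have h1 := hp.ncard_neighborSet_toSubgraph_eq_two hz
  have h2 : p.toSubgraph.neighborSet z = Γ.neighborSet z :=
    Set.eq_of_subset_of_ncard_le (p.toSubgraph.neighborSet_subset z)
      (by rw [h1]; exact hval.le) (Set.toFinite _)
  have h3 : t ∈ p.toSubgraph.neighborSet z := h2 ▸ hadj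
  exact (SimpleGraph.Walk.mem_edges_toSubgraph p).1 (SimpleGraph.Subgraph.mem_edgeSet.2 h3)

/-- The circle composed of an edge outside a subgraph `T` and a path of `T` between its ends. -/
theorem isCycle_cons_mapLe {T : SimpleGraph V} (le : T ≤ Γ) {u v : V} (huv : Γ.Adj u v)
    (hT : ¬ T.Adj u v) {q : T.Walk u v} (hq : q.IsPath) :
    (SimpleGraph.Walk.cons huv.symm (q.mapLe le)).IsCycle := by
  rw [SimpleGraph.Walk.cons_isCycle_iff]
  refine ⟨hq.mapLe le, fun h => ?_⟩
  rw [SimpleGraph.Walk.edges_mapLe_eq_edges] at h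
  exact hT (q.adj_of_mem_edges h).symm

/-- There is a maximal tree such that every edge outside of it contains a vertex of valency `≠ 2`,
unless `Γ` has no such vertex: a minimal connected graph among those that contain all other edges.
A circle in this graph would have an edge that can be removed. -/
theorem exists_cutting_tree [Finite V] (hconn : Γ.Connected) : ∃ T ≤ Γ, T.IsTree ∧
    ∀ u v, Γ.Adj u v → ¬ T.Adj u v →
      (valency Γ u ≠ 2 ∨ valency Γ v ≠ 2) ∨ ∀ z, valency Γ z = 2 := by
  set good : Sym2 V → Prop := fun d => (∃ x ∈ d, valency Γ x ≠ 2) ∨ ∀ z, valency Γ z = 2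
  obtain ⟨T, ⟨hle, hTconn, hTgood⟩, hmin⟩ := Set.Finite.exists_minimal
    (s := {G : SimpleGraph V | G ≤ Γ ∧ G.Connected ∧ ∀ e ∈ Γ.edgeSet, ¬ good e → e ∈ G.edgeSet})
    (Set.toFinite _) ⟨Γ, le_rfl, hconn, fun e he _ => he⟩
  refine ⟨T, hle, ⟨hTconn, ?_⟩, ?_⟩
  · intro a p hp
    have hp' : (p.mapLe hle).IsCycle := hp.mapLe hle
    have hex : ∃ d ∈ p.edges, good d := by
      by_cases hess : ∃ x ∈ p.support, valency Γ x ≠ 2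
      · obtain ⟨x, hx, hxv⟩ := hess
        obtain ⟨t, ht⟩ := exists_adj_of_mem_cycle hp hx
        exact ⟨s(x, t), ht, Or.inl ⟨x, Sym2.mem_mk_left _ _, hxv⟩⟩
      · -- a circle without essential vertices exhausts the connected graph
        push Not at hess
        obtain ⟨t, ht⟩ := exists_adj_of_mem_cycle hp p.start_mem_support
        refine ⟨s(a, t), ht, Or.inr fun z => hess z ?_⟩
        have hz := (SimpleGraph.reachable_iff_reflTransGen a z).1 (hconn a z)
        induction hz with
        | refl => exact p.start_mem_support
        | @tail b c _ hbc ih =>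
          have h1 := mem_edges_of_mem_cycle hp' (z := b) (t := c)
            (by rw [SimpleGraph.Walk.support_mapLe_eq_support]; exact ih) (hess b ih) hbc
          rw [SimpleGraph.Walk.edges_mapLe_eq_edges] at h1
          exact p.snd_mem_support_of_mem_edges h1
    obtain ⟨d, hd, hdg⟩ := hex
    have hdT : d ∈ T.edgeSet := p.edges_subset_edgeSet hd
    induction d with | _ x y
    have hbr : ¬ T.IsBridge s(x, y) := fun h =>
      (SimpleGraph.isBridge_iff_forall_cycle_notMem hdT).1 h p hp hd
    have hconn' := hTconn.connected_delete_edge_of_not_isBridge hbr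
    have hle' : T.deleteEdges {s(x, y)} ≤ T := SimpleGraph.deleteEdges_le _
    have h2 := hmin (y := T.deleteEdges {s(x, y)}) ⟨hle'.trans hle, hconn', fun e he hg => by
      rw [SimpleGraph.edgeSet_deleteEdges]
      refine ⟨hTgood e he hg, ?_⟩
      rintro rfl
      exact hg hdg⟩ hle'
    have h3 : (T.deleteEdges {s(x, y)}).Adj x y := h2 hdT
    simp at h3
  · intro u v huv hT
    by_contra hcon
    refine hT (hTgood s(u, v) huv fun hg => hcon ?_)
    rcases hg with ⟨x, hx, hxv⟩ | h
    · rcases Sym2.mem_iff.1 hx with rfl | rfl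
      · exact Or.inl (Or.inl hxv)
      · exact Or.inl (Or.inr hxv)
    · exact Or.inr h

variable [Fintype V] {T : SimpleGraph V}

/-- The path of the tree between the ends of an edge outside of it, and the edges of `Γ` at the
vertices of this path. -/
theorem exists_path_of_deleted (le : T ≤ Γ) (hT : T.IsTree)
    (hC : ∀ (a : V) (p : Γ.Walk a a), p.IsCycle → ∀ x ∈ p.support, ∀ y ∈ p.support,
      valency Γ x ≠ 2 → valency Γ y ≠ 2 → x = y)
    (hgood : ∀ u v, Γ.Adj u v → ¬ T.Adj u v →
      (valency Γ u ≠ 2 ∨ valency Γ v ≠ 2) ∨ ∀ z, valency Γ z = 2)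
    {u v : V} (huv : Γ.Adj u v) (huvT : ¬ T.Adj u v) :
    ∃ q : T.Walk u v, q.IsPath ∧ (∀ z ∈ q.support, z ≠ u → z ≠ v → valency Γ z = 2) ∧
      ∀ z ∈ q.support, valency Γ z = 2 → ∀ t, Γ.Adj z t →
        s(z, t) = s(v, u) ∨ s(z, t) ∈ q.edges := by
  obtain ⟨q, hq⟩ := (hT.existsUnique_path u v).exists
  have hcyc := isCycle_cons_mapLe le huv huvT hq
  have hsupp : ∀ z ∈ q.support,
      z ∈ (SimpleGraph.Walk.cons huv.symm (q.mapLe le)).support := by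
    intro z hz
    rw [SimpleGraph.Walk.support_cons, SimpleGraph.Walk.support_mapLe_eq_support]
    exact List.mem_cons_of_mem _ hz
  refine ⟨q, hq, fun z hz hzu hzv => ?_, fun z hz hval t ht => ?_⟩
  · by_contra hval
    rcases hgood u v huv huvT with (h | h) | h
    · exact hzu (hC _ _ hcyc z (hsupp z hz) u (hsupp u q.start_mem_support) hval h)
    · exact hzv (hC _ _ hcyc z (hsupp z hz) v (hsupp v q.end_mem_support) hval h)
    · exact hval (h z)
  · have h1 := mem_edges_of_mem_cycle hcyc (hsupp z hz) hval ht
    rw [SimpleGraph.Walk.edges_cons, SimpleGraph.Walk.edges_mapLe_eq_edges] at h1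
    exact List.mem_cons.1 h1

/-- A path of the tree that begins at the cut end `a` of a circle must run around the circle before
it comes to a vertex of valency `≠ 2` in the tree. -/
theorem le_length_of_deleted_end {n : ℕ} (hsub : SufficientlySubdivided n Γ) (le : T ≤ Γ)
    (hT : T.IsTree)
    (hC : ∀ (a : V) (p : Γ.Walk a a), p.IsCycle → ∀ x ∈ p.support, ∀ y ∈ p.support,
      valency Γ x ≠ 2 → valency Γ y ≠ 2 → x = y)
    (hgood : ∀ u v, Γ.Adj u v → ¬ T.Adj u v →
      (valency Γ u ≠ 2 ∨ valency Γ v ≠ 2) ∨ ∀ z, valency Γ z = 2)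
    {a b : V} (p : T.Walk a b) (hab : a ≠ b) (ha : valency Γ a = 2) (haT : valency T a ≠ 2)
    (hbT : valency T b ≠ 2) : n ≤ p.length := by
  classical
  obtain ⟨y, hay, hayT⟩ : ∃ y, Γ.Adj a y ∧ ¬ T.Adj a y := by
    by_contra hcon
    push Not at hcon
    exact haT ((le_antisymm (valency_mono le a)
      (Set.ncard_le_ncard (fun y hy => hcon y hy) (Set.toFinite _))).trans ha)
  obtain ⟨q, hq, hq1, hq2⟩ := exists_path_of_deleted le hT hC hgood hay hayT
  have hval : ∀ z ∈ q.support, z ≠ y → valency Γ z = 2 := by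
    intro z hz hzy
    by_cases hza : z = a
    · rw [hza, ha]
    · exact hq1 z hz hza hzy
  have hy : y ∈ p.support := by
    by_contra hy
    have hstay : ∀ {c d : V} (r : T.Walk c d), y ∉ r.support → c ∈ q.support → d ∈ q.support := by
      intro c d r
      induction r with
      | nil => exact fun _ h => h
      | @cons c e d hce r ih =>
        intro hyr hc
        have hyc : c ≠ y := by rintro rfl; exact hyr (by simp)
        refine ih (fun h => hyr (by simp [h])) ?_
        rcases hq2 c hc (hval c hc hyc) e (le hce) with h | h
        · rcases Sym2.eq_iff.1 h with ⟨rfl, -⟩ | ⟨-, rfl⟩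
          · exact absurd rfl hyc
          · exact q.end_mem_support
        · exact q.snd_mem_support_of_mem_edges h
    have hb := hstay p hy q.start_mem_support
    have hby : b ≠ y := by rintro rfl; exact hy p.end_mem_support
    have hvb := hval b hb hby
    refine hbT ((le_antisymm (valency_mono le b) (Set.ncard_le_ncard (fun t ht => ?_)
      (Set.toFinite _))).trans hvb)
    rcases hq2 b hb hvb t ht with h | h
    · rcases Sym2.eq_iff.1 h with ⟨h1, -⟩ | ⟨h1, -⟩
      · exact absurd h1 hby
      · exact absurd h1.symm hab
    · exact q.adj_of_mem_edges h
  have h1 := hsub.cycle_length _ _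
    (isCycle_cons_mapLe le hay hayT (p.takeUntil y hy).bypass_isPath)
  have h2 := (p.takeUntil y hy).length_bypass_le_length
  have h3 := p.length_takeUntil_le_length hy
  rw [SimpleGraph.Walk.length_cons, SimpleGraph.Walk.length_map] at h1
  omega

/-- Cutting the circles at their essential vertices does not shorten the distances between vertices
of valency `≠ 2` too much: a new end is as far from the cut as the circle is long. -/
theorem sufficientlySubdivided_of_cutting {n : ℕ} (hsub : SufficientlySubdivided n Γ) (le : T ≤ Γ)
    (hT : T.IsTree)
    (hC : ∀ (a : V) (p : Γ.Walk a a), p.IsCycle → ∀ x ∈ p.support, ∀ y ∈ p.support,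
      valency Γ x ≠ 2 → valency Γ y ≠ 2 → x = y)
    (hgood : ∀ u v, Γ.Adj u v → ¬ T.Adj u v →
      (valency Γ u ≠ 2 ∨ valency Γ v ≠ 2) ∨ ∀ z, valency Γ z = 2) :
    SufficientlySubdivided n T where
  card_le := hsub.card_le
  path_length a b p _ hab ha hb := by
    by_cases hva : valency Γ a = 2
    · exact (le_length_of_deleted_end hsub le hT hC hgood p hab hva ha hb).trans (Nat.le_succ _)
    by_cases hvb : valency Γ b = 2
    · have h := le_length_of_deleted_end hsub le hT hC hgood p.reverse hab.symm hvb hb ha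
      rw [SimpleGraph.Walk.length_reverse] at h
      exact h.trans (Nat.le_succ _)
    · have h := hsub.le_length (p.mapLe le) hab hva hvb
      rwa [SimpleGraph.Walk.length_map] at h
  cycle_length a p hp := absurd hp (hT.isAcyclic p)

end CuttingTree

theorem exists_orderedTree_cutsWell {V : Type u} [Fintype V] [Nontrivial V] {Γ : SimpleGraph V}
    {n : ℕ} (hconn : Γ.Connected) (hsub : SufficientlySubdivided n Γ)
    (hC : ∀ (a : V) (p : Γ.Walk a a), p.IsCycle → ∀ x ∈ p.support, ∀ y ∈ p.support,
      valency Γ x ≠ 2 → valency Γ y ≠ 2 → x = y) :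
    ∃ D : OrderedTree Γ n, D.CutsWell := by
  obtain ⟨T, le, hT, hgood⟩ := exists_cutting_tree hconn
  obtain ⟨D, rfl⟩ := exists_orderedTree le hT
    (sufficientlySubdivided_of_cutting hsub le hT hC hgood)
  refine ⟨D, fun u v huv huvT => ?_, fun u v huv huvT => ?_⟩
  · by_contra hcon
    push Not at hcon
    have h1 : D.T.neighborSet u ⊂ Γ.neighborSet u :=
      ⟨fun _ h => le h, fun h => huvT (h huv)⟩
    have h2 := Set.ncard_lt_ncard h1 (Set.toFinite _)
    change valency D.T u < valency Γ u at h2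
    omega
  · obtain ⟨q, -, hq1, hq2⟩ := exists_path_of_deleted le hT hC hgood huv huvT
    refine ⟨q, fun z hz hzu hzv => ⟨hq1 z hz hzu hzv, fun t ht => ?_⟩⟩
    rcases hq2 z hz (hq1 z hz hzu hzv) t ht with h | h
    · rcases Sym2.eq_iff.1 h with ⟨h1, -⟩ | ⟨h1, -⟩
      · exact absurd h1 hzv
      · exact absurd h1 hzu
    · exact ⟨q.adj_of_mem_edges h, q.snd_mem_support_of_mem_edges h⟩

/-! ### Subdivisions inside a graph -/

theorem mem_support_map_iso {W W' : Type*} {H : SimpleGraph W} {H' : SimpleGraph W'}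
    (e : H ≃g H') {x y : W} (p : H.Walk x y) (z : W) :
    e z ∈ (p.map e.toHom).support ↔ z ∈ p.support := by
  rw [SimpleGraph.Walk.support_map]
  exact List.mem_map_of_injective e.injective

/-- Transport of a subdivision along an isomorphism. -/
def Subdivision.congr {U W W' : Type*} {G : SimpleGraph U} {H : SimpleGraph W}
    {H' : SimpleGraph W'} (s : Subdivision G H) (e : H ≃g H') : Subdivision G H' where
  vert := s.vert.trans e.toEquiv.toEmbedding
  path h := (s.path h).map e.toHom
  isPath h := (s.isPath h).map e.injective
  path_symm h := (congrArg _ (s.path_symm h)).trans (SimpleGraph.Walk.reverse_map _ _).symm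
  vert_mem h v hv := s.vert_mem h v ((mem_support_map_iso e _ _).1 hv)
  disjoint h h' x hx hx' := by
    obtain ⟨y, rfl⟩ := e.surjective x
    refine (s.disjoint h h' y ((mem_support_map_iso e _ _).1 hx)
      ((mem_support_map_iso e _ _).1 hx')).imp_right ?_
    rintro ⟨v, rfl⟩
    exact ⟨v, rfl⟩
  cover_vert x := by
    obtain ⟨y, rfl⟩ := e.surjective x
    rcases s.cover_vert y with ⟨v, rfl⟩ | ⟨a, b, h, hy⟩
    · exact Or.inl ⟨v, rfl⟩
    · exact Or.inr ⟨a, b, h, (mem_support_map_iso e _ _).2 hy⟩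
  cover_edge x hx := by
    induction x with | _ x y
    obtain ⟨x, rfl⟩ := e.surjective x
    obtain ⟨y, rfl⟩ := e.surjective y
    obtain ⟨a, b, h, hy⟩ := s.cover_edge s(x, y) (e.map_adj_iff.1 hx)
    refine ⟨a, b, h, ?_⟩
    have h2 := SimpleGraph.Walk.edges_map e.toHom (s.path h)
    exact h2 ▸ List.mem_map_of_mem (f := Sym2.map e) hy

/-- A walk can be pulled back along an injective map whose image contains its vertices, if its edges
come from edges. -/
theorem exists_walk_lift {W W' : Type*} {K : SimpleGraph W'} {H : SimpleGraph W} (g : W' ↪ W)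
    {x y : W} (p : H.Walk x y) :
    ∀ (x' y' : W'), g x' = x → g y' = y → (∀ z ∈ p.support, z ∈ Set.range g) →
      (∀ z w : W', s(g z, g w) ∈ p.edges → K.Adj z w) →
      ∃ q : K.Walk x' y', q.support.map g = p.support ∧ q.edges.map (Sym2.map g) = p.edges := by
  induction p with
  | nil =>
    intro x' y' hx hy _ _
    obtain rfl : x' = y' := g.injective (hx.trans hy.symm)
    exact ⟨.nil, by simp [hx], by simp⟩
  | @cons a b c hab p ih =>
    intro x' y' hx hy hs he
    obtain ⟨b', hb'⟩ := hs b (by simp)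
    obtain ⟨q, hq, hq'⟩ := ih b' y' hb' hy (fun z hz => hs z (by simp [hz]))
      (fun z w h => he z w (by simp [h]))
    exact ⟨.cons (he x' b' (by simp [hx, hb'])) q, by simp [hq, hx], by simp [hq', hx, hb']⟩

/-- A system of paths of `H`, one for each edge of `G`, that meet at their ends only, is a
subdivision of `G` contained in `H`. -/
theorem exists_subdivision_of_paths {U W : Type*} [Finite W] {G : SimpleGraph U}
    {H : SimpleGraph W} (vert : U ↪ W)
    (path : ∀ {a b : U}, G.Adj a b → H.Walk (vert a) (vert b))
    (isPath : ∀ {a b : U} (h : G.Adj a b), (path h).IsPath)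
    (path_symm : ∀ {a b : U} (h : G.Adj a b), path h.symm = (path h).reverse)
    (vert_mem : ∀ {a b : U} (h : G.Adj a b) (v : U), vert v ∈ (path h).support → v = a ∨ v = b)
    (disjoint : ∀ {a b a' b' : U} (h : G.Adj a b) (h' : G.Adj a' b') (x : W),
      x ∈ (path h).support → x ∈ (path h').support → s(a, b) = s(a', b') ∨ x ∈ Set.range vert) :
    ∃ (m : ℕ) (K : SimpleGraph (Fin m)), Nonempty (Subdivision G K) ∧ K.IsContained H := by
  set S : Set W := {x | x ∈ Set.range vert ∨ ∃ (a b : U) (h : G.Adj a b), x ∈ (path h).support}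
  obtain ⟨m, ⟨e⟩⟩ := Finite.exists_equiv_fin S
  let g : Fin m ↪ W := e.symm.toEmbedding.trans (Function.Embedding.subtype _)
  have hg : ∀ x ∈ S, x ∈ Set.range g := fun x hx => ⟨e ⟨x, hx⟩, by simp [g]⟩
  have hgS : ∀ i, g i ∈ S := fun i => (e.symm i).2
  let K : SimpleGraph (Fin m) :=
    { Adj := fun i j => ∃ (a b : U) (h : G.Adj a b), s(g i, g j) ∈ (path h).edges
      symm := ⟨fun i j ⟨a, b, h, hij⟩ => ⟨a, b, h, by rwa [Sym2.eq_swap]⟩⟩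
      loopless := ⟨fun i ⟨a, b, h, hij⟩ =>
        ((path h).adj_of_mem_edges hij).ne rfl⟩ }
  have hvert : ∀ u, ∃ i, g i = vert u := fun u => hg _ (Or.inl ⟨u, rfl⟩)
  choose vert' hvert' using hvert
  have hlift : ∀ (a b : U) (h : G.Adj a b), ∃ q : K.Walk (vert' a) (vert' b),
      q.support.map g = (path h).support ∧ q.edges.map (Sym2.map g) = (path h).edges :=
    fun a b h => exists_walk_lift g (path h) _ _ (hvert' a) (hvert' b)
      (fun z hz => hg z (Or.inr ⟨a, b, h, hz⟩)) fun z w hzw => ⟨a, b, h, hzw⟩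
  choose q hq hqe using hlift
  have hmem : ∀ {a b : U} (h : G.Adj a b) (i : Fin m),
      i ∈ (q a b h).support ↔ g i ∈ (path h).support := by
    intro a b h i
    rw [← hq]
    exact (List.mem_map_of_injective g.injective).symm
  refine ⟨m, K, ⟨⟨⟨vert', fun u v h => vert.injective ?_⟩, fun {a b} h => q a b h, ?_, ?_, ?_, ?_,
    ?_, ?_⟩⟩, ⟨⟨⟨g, ?_⟩, g.injective⟩⟩⟩
  · rw [← hvert', ← hvert', h]
  · intro a b h
    rw [SimpleGraph.Walk.isPath_def]
    refine List.Nodup.of_map g ?_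
    rw [hq]
    exact (isPath h).support_nodup
  · intro a b h
    apply SimpleGraph.Walk.ext_support
    apply g.injective.list_map
    rw [SimpleGraph.Walk.support_reverse, List.map_reverse, hq, hq, path_symm,
      SimpleGraph.Walk.support_reverse]
  · intro a b h v hv
    have h1 : g (vert' v) ∈ (path h).support := (hmem h _).1 hv
    rw [hvert'] at h1
    exact vert_mem h v h1
  · intro a b a' b' h h' i hi hi'
    refine (disjoint h h' (g i) ((hmem h i).1 hi) ((hmem h' i).1 hi')).imp_right ?_
    rintro ⟨u, hu⟩
    exact ⟨u, g.injective ((hvert' u).trans hu)⟩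
  · intro i
    rcases hgS i with ⟨u, hu⟩ | ⟨a, b, h, hi⟩
    · exact Or.inl ⟨u, g.injective ((hvert' u).trans hu)⟩
    · exact Or.inr ⟨a, b, h, (hmem h i).2 hi⟩
  · intro d hd
    induction d with | _ i j
    obtain ⟨a, b, h, hij⟩ := hd
    refine ⟨a, b, h, ?_⟩
    rw [← hqe] at hij
    exact (List.mem_map_of_injective (Sym2.map.injective g.injective)).1 hij
  · rintro i j ⟨a, b, h, hij⟩
    exact (path h).adj_of_mem_edges hij

theorem S₀_cases {a b : Fin 5} (h : S₀.Adj a b) (hab : a < b) : (a = 0 ∧ b = 1) ∨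
    (a = 1 ∧ b = 2) ∨ (a = 1 ∧ b = 3) ∨ (a = 2 ∧ b = 3) ∨ (a = 3 ∧ b = 4) := by
  have h1 := ((SimpleGraph.fromEdgeSet_adj _).1 h).1
  simp only [Set.mem_insert_iff, Set.mem_singleton_iff, Sym2.eq_iff] at h1
  omega

/-- A circle made of an edge `1-2` and two paths `1-3` and `2-3`, with pendant edges at `1` and
`3`. -/
theorem exists_subdivision_S₀ {W : Type*} [Finite W] {H : SimpleGraph W} (v : Fin 5 ↪ W)
    (P : H.Walk (v 1) (v 3)) (Q : H.Walk (v 2) (v 3)) (hP : P.IsPath) (hQ : Q.IsPath)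
    (h01 : H.Adj (v 0) (v 1)) (h12 : H.Adj (v 1) (v 2)) (h34 : H.Adj (v 3) (v 4))
    (hPv : ∀ j, v j ∈ P.support → j = 1 ∨ j = 3) (hQv : ∀ j, v j ∈ Q.support → j = 2 ∨ j = 3)
    (hPQ : ∀ x ∈ P.support, x ∈ Q.support → x = v 3) :
    ∃ (m : ℕ) (K : SimpleGraph (Fin m)), Nonempty (Subdivision S₀ K) ∧ K.IsContained H := by
  have hex : ∀ a b : Fin 5, S₀.Adj a b → a < b → ∃ p : H.Walk (v a) (v b), p.IsPath ∧
      (∀ j, v j ∈ p.support → j = a ∨ j = b) ∧ ∀ x ∈ p.support, x ∈ Set.range v ∨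
        (a = 1 ∧ b = 3 ∧ x ∈ P.support) ∨ (a = 2 ∧ b = 3 ∧ x ∈ Q.support) := by
    have hedge : ∀ {a b : Fin 5} (h : H.Adj (v a) (v b)), (h.toWalk).IsPath ∧
        (∀ j, v j ∈ h.toWalk.support → j = a ∨ j = b) ∧
        ∀ x ∈ h.toWalk.support, x ∈ Set.range v := by
      intro a b h
      refine ⟨by simpa using h.ne, fun j hj => by simpa using hj, fun x hx => ?_⟩
      have hx' : x = v a ∨ x = v b := by simpa using hx
      rcases hx' with rfl | rfl
      · exact ⟨a, rfl⟩
      · exact ⟨b, rfl⟩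
    intro a b h hab
    rcases S₀_cases h hab with ⟨rfl, rfl⟩ | ⟨rfl, rfl⟩ | ⟨rfl, rfl⟩ | ⟨rfl, rfl⟩ | ⟨rfl, rfl⟩
    · exact ⟨_, (hedge h01).1, (hedge h01).2.1, fun x hx => Or.inl ((hedge h01).2.2 x hx)⟩
    · exact ⟨_, (hedge h12).1, (hedge h12).2.1, fun x hx => Or.inl ((hedge h12).2.2 x hx)⟩
    · exact ⟨P, hP, hPv, fun x hx => Or.inr (Or.inl ⟨rfl, rfl, hx⟩)⟩
    · exact ⟨Q, hQ, hQv, fun x hx => Or.inr (Or.inr ⟨rfl, rfl, hx⟩)⟩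
    · exact ⟨_, (hedge h34).1, (hedge h34).2.1, fun x hx => Or.inl ((hedge h34).2.2 x hx)⟩
  choose p hp hpv hpx using hex
  have hflip : ∀ {a b : Fin 5}, S₀.Adj a b → ¬ a < b → b < a := fun h hab =>
    lt_of_le_of_ne (not_lt.1 hab) h.ne'
  let path : ∀ {a b : Fin 5}, S₀.Adj a b → H.Walk (v a) (v b) := fun {a b} h =>
    if hab : a < b then p a b h hab else (p b a h.symm (hflip h hab)).reverse
  -- reduction of statements about `path` to the paths that ascend
  have hpath : ∀ {a b : Fin 5} (h : S₀.Adj a b), ∃ a' b', ∃ h' : S₀.Adj a' b', ∃ hab : a' < b',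
      s(a, b) = s(a', b') ∧ ∀ x, x ∈ (path h).support ↔ x ∈ (p a' b' h' hab).support := by
    intro a b h
    by_cases hab : a < b
    · exact ⟨a, b, h, hab, rfl, fun x => by simp [path, hab]⟩
    · exact ⟨b, a, h.symm, hflip h hab, Sym2.eq_swap, fun x => by simp [path, hab]⟩
  refine exists_subdivision_of_paths v path ?_ ?_ ?_ ?_
  · intro a b h
    by_cases hab : a < b
    · simp only [path, hab, dif_pos]
      exact hp _ _ _ _
    · simp only [path, hab, dif_neg, not_false_eq_true]
      exact (hp _ _ _ _).reverse
  · intro a b h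
    by_cases hab : a < b
    · simp [path, hab, hab.not_gt]
    · simp [path, hab, hflip h hab]
  · intro a b h j hj
    obtain ⟨a', b', h', hab, hs, hx⟩ := hpath h
    have h1 := hpv a' b' h' hab j ((hx _).1 hj)
    rw [← Sym2.mem_iff] at h1 ⊢
    rwa [hs]
  · intro a b c d h k x hx hx'
    obtain ⟨a', b', h', hab, hs, hm⟩ := hpath h
    obtain ⟨c', d', k', hcd, ht, hn⟩ := hpath k
    rw [hs, ht]
    rcases hpx _ _ _ _ x ((hm x).1 hx) with h1 | ⟨rfl, rfl, h1⟩ | ⟨rfl, rfl, h1⟩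
    · exact Or.inr h1
    all_goals
      rcases hpx _ _ _ _ x ((hn x).1 hx') with h2 | ⟨rfl, rfl, h2⟩ | ⟨rfl, rfl, h2⟩
      · exact Or.inr h2
    · exact Or.inl rfl
    · exact Or.inr ⟨3, (hPQ x h1 h2).symm⟩
    · exact Or.inr ⟨3, (hPQ x h2 h1).symm⟩
    · exact Or.inl rfl

/-! ### Graphs that do not contain `S₀` -/

section Essential

variable {V : Type*} (Γ : SimpleGraph V)

/-- The subdivision of a graph in which every edge is divided into three. The oriented edge `(a, b)`
stands for the new vertex on `ab` next to `a`. -/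
def tripleSubdivision : SimpleGraph (V ⊕ Γ.Dart) where
  Adj
    | .inl a, .inr d => d.fst = a
    | .inr d, .inl a => d.fst = a
    | .inr d, .inr d' => d' = d.symm
    | .inl _, .inl _ => False
  symm := ⟨by
    rintro (a | d) (b | d') h
    · exact h
    · exact h
    · exact h
    · change d' = d.symm at h
      change d = d'.symm
      rw [h, SimpleGraph.Dart.symm_symm]⟩
  loopless := ⟨by
    rintro (a | d) h
    · exact h
    · exact d.symm_ne h.symm⟩

variable {Γ}

theorem tripleSubdivision_adj_inl {a b : V} (h : Γ.Adj a b) :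
    (tripleSubdivision Γ).Adj (.inl a) (.inr ⟨(a, b), h⟩) := rfl

theorem tripleSubdivision_adj_inr {a b : V} (h : Γ.Adj a b) :
    (tripleSubdivision Γ).Adj (.inr ⟨(a, b), h⟩) (.inr ⟨(b, a), h.symm⟩) := rfl

theorem tripleSubdivision_adj_inr_inl {a b : V} (h : Γ.Adj a b) :
    (tripleSubdivision Γ).Adj (.inr ⟨(b, a), h.symm⟩) (.inl b) := rfl

/-- The image of a walk in the triple subdivision. -/
def tripleWalk : ∀ {a b : V}, Γ.Walk a b → (tripleSubdivision Γ).Walk (.inl a) (.inl b)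
  | _, _, .nil => .nil
  | _, _, .cons h p => .cons (tripleSubdivision_adj_inl h) (.cons (tripleSubdivision_adj_inr h)
      (.cons (tripleSubdivision_adj_inr_inl h) (tripleWalk p)))

theorem inl_mem_tripleWalk {a b : V} (p : Γ.Walk a b) (x : V) :
    .inl x ∈ (tripleWalk p).support ↔ x ∈ p.support := by
  induction p with
  | nil => simp [tripleWalk]
  | cons h p ih => simp [tripleWalk, ih]

theorem dart_eq_or_eq_symm {a b : V} (h : Γ.Adj a b) (d : Γ.Dart) :
    d.edge = s(a, b) ↔ d = ⟨(a, b), h⟩ ∨ d = ⟨(b, a), h.symm⟩ :=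
  SimpleGraph.dart_edge_eq_iff d ⟨(a, b), h⟩

theorem inr_mem_tripleWalk {a b : V} (p : Γ.Walk a b) (d : Γ.Dart) :
    .inr d ∈ (tripleWalk p).support ↔ d.edge ∈ p.edges := by
  induction p with
  | nil => simp [tripleWalk]
  | cons h p ih => simp [tripleWalk, ih, dart_eq_or_eq_symm h, or_assoc]

theorem tripleWalk_isPath {a b : V} {p : Γ.Walk a b} (hp : p.IsPath) : (tripleWalk p).IsPath := by
  induction p with
  | nil => exact .nil
  | @cons a c b h p ih =>
    rw [SimpleGraph.Walk.cons_isPath_iff] at hp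
    have hne : s(a, c) ∉ p.edges := fun he => hp.2 (p.fst_mem_support_of_mem_edges he)
    have h1 : Sum.inr ⟨(a, c), h⟩ ∉ (tripleWalk p).support := by rwa [inr_mem_tripleWalk]
    have h2 : Sum.inr ⟨(c, a), h.symm⟩ ∉ (tripleWalk p).support := by
      rw [inr_mem_tripleWalk]
      change s(c, a) ∉ p.edges
      rwa [Sym2.eq_swap]
    have h3 : Sum.inl a ∉ (tripleWalk p).support := by rw [inl_mem_tripleWalk]; exact hp.2
    simp only [tripleWalk, SimpleGraph.Walk.cons_isPath_iff, SimpleGraph.Walk.support_cons,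
      List.mem_cons, not_or]
    refine ⟨⟨⟨ih hp.1, h2⟩, ?_, h1⟩, by simp, by simp, h3⟩
    intro heq
    have := congrArg (fun d : Γ.Dart => d.fst) (Sum.inr.inj heq)
    exact h.ne this

/-- The triple subdivision is a subdivision. -/
def subdivisionTriple (Γ : SimpleGraph V) : Subdivision Γ (tripleSubdivision Γ) where
  vert := .inl
  path h := tripleWalk h.toWalk
  isPath h := tripleWalk_isPath (by simpa using h.ne)
  path_symm h := rfl
  vert_mem h v hv := by simpa using (inl_mem_tripleWalk h.toWalk v).1 hv
  disjoint {a b a' b'} h h' x hx hx' := by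
    rcases x with x | d
    · exact Or.inr ⟨x, rfl⟩
    · have h1 := (inr_mem_tripleWalk _ _).1 hx
      have h2 := (inr_mem_tripleWalk _ _).1 hx'
      exact Or.inl ((List.mem_singleton.1 h1).symm.trans (List.mem_singleton.1 h2))
  cover_vert x := by
    rcases x with x | d
    · exact Or.inl ⟨x, rfl⟩
    · exact Or.inr ⟨d.fst, d.snd, d.adj,
        (inr_mem_tripleWalk _ d).2 (by simp [SimpleGraph.Dart.edge])⟩
  cover_edge e he := by
    have key : ∀ d : Γ.Dart, s(.inl d.fst, .inr d) ∈ (tripleWalk d.adj.toWalk).edges ∧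
        s(.inr d, .inr d.symm) ∈ (tripleWalk d.adj.toWalk).edges := fun d =>
      ⟨List.mem_cons_self, List.mem_cons_of_mem _ List.mem_cons_self⟩
    induction e with | _ x y
    rcases x with a | d <;> rcases y with b | d'
    · exact he.elim
    · obtain rfl : d'.fst = a := he
      exact ⟨_, _, d'.adj, (key d').1⟩
    · obtain rfl : d.fst = b := he
      exact ⟨_, _, d.adj, by rw [Sym2.eq_swap]; exact (key d).1⟩
    · obtain rfl : d' = d.symm := he
      exact ⟨_, _, d.adj, (key d).2⟩

/-- A vertex of valency `≠ 2` on a circle has an edge outside the circle. -/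
theorem exists_adj_notMem_cycle [Finite V] {a x : V} {p : Γ.Walk a a} (hp : p.IsCycle)
    (hx : x ∈ p.support) (hval : valency Γ x ≠ 2) : ∃ y, Γ.Adj x y ∧ s(x, y) ∉ p.edges := by
  have h1 := hp.ncard_neighborSet_toSubgraph_eq_two hx
  by_contra hcon
  push Not at hcon
  apply hval
  rw [← h1]
  refine congrArg Set.ncard (a₁ := Γ.neighborSet x) ?_
  refine Set.Subset.antisymm (fun y hy => ?_) (p.toSubgraph.neighborSet_subset x)
  have h2 := (SimpleGraph.Walk.mem_edges_toSubgraph p).2 (hcon y hy)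
  exact SimpleGraph.Subgraph.mem_edgeSet.1 h2

/-- If `Γ` does not contain `S₀`, then no circle of `Γ` has two vertices of valency `≠ 2`: the
triple subdivision of such a circle with an outer edge at each of these vertices would contain a
subdivision of `S₀`. -/
theorem cycle_essential_unique [Finite V] (hS : ¬ Contains Γ S₀) (a : V) (p : Γ.Walk a a)
    (hp : p.IsCycle) (x : V) (hx : x ∈ p.support) (y : V) (hy : y ∈ p.support)
    (hxv : valency Γ x ≠ 2) (hyv : valency Γ y ≠ 2) : x = y := by
  classical
  by_contra hxy
  obtain ⟨x', hxx', hx'⟩ := exists_adj_notMem_cycle hp hx hxv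
  obtain ⟨y', hyy', hy'⟩ := exists_adj_notMem_cycle hp hy hyv
  have hp' : (p.rotate x hx).IsCycle := hp.rotate hx
  have hedges : ∀ e, e ∈ (p.rotate x hx).edges ↔ e ∈ p.edges :=
    fun e => (p.rotate_edges x hx).mem_iff
  rw [← hedges] at hx' hy'
  rw [← p.mem_support_rotate_iff x hx] at hy
  generalize p.rotate x hx = r at hp' hx' hy' hy
  -- the two arcs of the circle between `x` and `y`
  obtain ⟨P, R, rfl⟩ := SimpleGraph.Walk.mem_support_iff_exists_append.1 hy
  have hnd := hp'.support_nodup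
  rw [SimpleGraph.Walk.tail_support_append, List.nodup_append] at hnd
  obtain ⟨hPn, hRn, hPR⟩ := hnd
  have htail : ∀ {c d z : V} (q : Γ.Walk c d), z ∈ q.support ↔ z = c ∨ z ∈ q.support.tail :=
    fun q => by
      rw [← List.mem_cons, SimpleGraph.Walk.cons_tail_support]
  have hxR : x ∈ R.support.tail := ((htail R).1 R.end_mem_support).resolve_left hxy
  have hyP : y ∈ P.support.tail := ((htail P).1 P.end_mem_support).resolve_left (Ne.symm hxy)
  have hP : P.IsPath := by
    rw [SimpleGraph.Walk.isPath_def, ← SimpleGraph.Walk.cons_tail_support, List.nodup_cons]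
    exact ⟨fun h => hPR x h x hxR rfl, hPn⟩
  have hR : R.IsPath := by
    rw [SimpleGraph.Walk.isPath_def, ← SimpleGraph.Walk.cons_tail_support, List.nodup_cons]
    exact ⟨fun h => hPR y hyP y h rfl, hRn⟩
  have hmeet : ∀ z, z ∈ P.support → z ∈ R.support → z = x ∨ z = y := by
    intro z hzP hzR
    rcases (htail P).1 hzP with h | h
    · exact Or.inl h
    rcases (htail R).1 hzR with h' | h'
    · exact Or.inr h'
    · exact absurd rfl (hPR z h z h')
  have hed := hp'.edges_nodup
  rw [SimpleGraph.Walk.edges_append, List.nodup_append] at hed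
  rw [SimpleGraph.Walk.edges_append, List.mem_append, not_or] at hx' hy'
  have hRr := hR.reverse
  have hmeet' : ∀ z, z ∈ P.support → z ∈ R.reverse.support → z = x ∨ z = y := by
    intro z hz hz'
    rw [SimpleGraph.Walk.support_reverse, List.mem_reverse] at hz'
    exact hmeet z hz hz'
  have hedr : ∀ e ∈ P.edges, e ∉ R.reverse.edges := by
    intro e he he'
    rw [SimpleGraph.Walk.edges_reverse, List.mem_reverse] at he'
    exact hed.2.2 e he e he' rfl
  have hxr : s(x, x') ∉ R.reverse.edges := by
    rw [SimpleGraph.Walk.edges_reverse, List.mem_reverse]; exact hx'.2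
  have hyr : s(y, y') ∉ R.reverse.edges := by
    rw [SimpleGraph.Walk.edges_reverse, List.mem_reverse]; exact hy'.2
  generalize R.reverse = Q at hRr hmeet' hedr hxr hyr
  cases Q with
  | nil => exact hxy rfl
  | @cons _ z _ hxz Q =>
  rw [SimpleGraph.Walk.edges_cons] at hxr hyr hedr
  have hlift := tripleWalk_isPath hRr
  have hxPz : s(x, z) ∉ P.edges := fun h => hedr _ h (List.mem_cons_self)
  have hzx' : z ≠ x' := by rintro rfl; exact hxr List.mem_cons_self
  let v : Fin 5 → V ⊕ Γ.Dart := ![.inr ⟨(x, x'), hxx'⟩, .inl x, .inr ⟨(x, z), hxz⟩, .inl y,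
    .inr ⟨(y, y'), hyy'⟩]
  have hxy' : ∀ {c d : V} (h : Γ.Adj x c) (h' : Γ.Adj y d),
      (⟨(x, c), h⟩ : Γ.Dart) ≠ ⟨(y, d), h'⟩ :=
    fun h h' heq => hxy (congrArg (fun d : Γ.Dart => d.fst) heq)
  have hxx : (⟨(x, x'), hxx'⟩ : Γ.Dart) ≠ ⟨(x, z), hxz⟩ :=
    fun heq => hzx' (congrArg (fun d : Γ.Dart => d.snd) heq).symm
  have hv : Function.Injective v := by
    rw [← List.nodup_ofFn]
    simp only [v, List.ofFn_succ, List.ofFn_zero, Matrix.cons_val_zero, Matrix.cons_val_succ,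
      List.nodup_cons, List.mem_cons, List.not_mem_nil, Sum.inr.injEq, Sum.inl.injEq, reduceCtorEq,
      hxx, hxy' hxx' hyy', hxy' hxz hyy', hxy, or_self, not_false_eq_true, List.nodup_nil, and_self]
  -- the second arc of the circle, without its first edge
  set Q' : (tripleSubdivision Γ).Walk (.inr ⟨(x, z), hxz⟩) (.inl y) :=
    .cons (tripleSubdivision_adj_inr hxz) (.cons (tripleSubdivision_adj_inr_inl hxz) (tripleWalk Q))
  have hlift' : tripleWalk (.cons hxz Q) = .cons (tripleSubdivision_adj_inl hxz) Q' := rfl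
  rw [hlift', SimpleGraph.Walk.cons_isPath_iff] at hlift
  have hQ' : ∀ w ∈ Q'.support, w ∈ (tripleWalk (SimpleGraph.Walk.cons hxz Q)).support := by
    intro w hw
    rw [hlift', SimpleGraph.Walk.support_cons]
    exact List.mem_cons_of_mem _ hw
  have hQd : ∀ d : Γ.Dart, .inr d ∈ Q'.support → d.edge ∈ s(x, z) :: Q.edges :=
    fun d hd => (inr_mem_tripleWalk _ d).1 (hQ' _ hd)
  have hPd : ∀ d : Γ.Dart, .inr d ∈ (tripleWalk P).support → d.edge ∈ P.edges :=
    fun d hd => (inr_mem_tripleWalk _ d).1 hd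
  have : Finite Γ.Dart := Finite.of_injective _ SimpleGraph.Dart.toProd_injective
  obtain ⟨m, K, hK, hKH⟩ := exists_subdivision_S₀ (H := tripleSubdivision Γ) ⟨v, hv⟩
    (tripleWalk P) Q' (tripleWalk_isPath hP) hlift.1 (tripleSubdivision_adj_inl hxx').symm
    (tripleSubdivision_adj_inl hxz) (tripleSubdivision_adj_inl hyy')
    (fun j hj => by
      match j, hj with
      | 0, hj => exact absurd (hPd _ hj) hx'.1
      | 1, _ => exact Or.inl rfl
      | 2, hj => exact absurd (hPd _ hj) hxPz
      | 3, _ => exact Or.inr rfl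
      | 4, hj => exact absurd (hPd _ hj) hy'.1)
    (fun j hj => by
      match j, hj with
      | 0, hj => exact absurd (hQd _ hj) hxr
      | 1, hj => exact absurd hj hlift.2
      | 2, _ => exact Or.inl rfl
      | 3, _ => exact Or.inr rfl
      | 4, hj => exact absurd (hQd _ hj) hyr)
    (fun w hw hw' => by
      rcases w with w | d
      · rcases hmeet' w ((inl_mem_tripleWalk _ w).1 hw) ((inl_mem_tripleWalk _ w).1 (hQ' _ hw'))
          with rfl | rfl
        · exact absurd hw' hlift.2
        · rfl
      · exact absurd (hQd d hw') (hedr _ (hPd d hw)))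
  obtain ⟨M, ⟨e⟩⟩ := Finite.exists_equiv_fin (V ⊕ Γ.Dart)
  let iso := SimpleGraph.Iso.map e (tripleSubdivision Γ)
  exact hS ⟨M, m, _, K, ⟨(subdivisionTriple Γ).congr iso⟩, hK, hKH.trans iso.isContained⟩

end Essential

end GraphBraid

theorem mainTheorem7 {V : Type*} [Fintype V] [DecidableEq V] [Nontrivial V]
    (Γ : SimpleGraph V) (n : ℕ) (hconn : Γ.Connected)
    (hsub : GraphBraid.SufficientlySubdivided n Γ)
    (hS : ¬ GraphBraid.Contains Γ GraphBraid.S₀) :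
    ∃ D : GraphBraid.OrderedTree Γ n, D.RewritingStabilizes ∧
      ∃ hd : ∀ i : ℕ, (D.morseBoundary i).comp (D.morseBoundary (i + 1)) = 0,
        (∀ i j : ℕ, (D.morseComplex hd).d i j = 0) ∧
        ∀ i : ℕ, ∃ φ : (D.morseComplex hd).homology i ≅
            ModuleCat.of ℤ ({c : GraphBraid.Cell Γ n i // D.Critical c} →₀ ℤ),
          (D.morseComplex hd).homologyπ i ≫ φ.hom = (D.morseComplex hd).iCycles i := by
  obtain ⟨D, hD⟩ := GraphBraid.exists_orderedTree_cutsWell hconn hsub fun a p hp x hx y hy =>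
    GraphBraid.cycle_essential_unique hS a p hp x hx y hy
  have h0 : ∀ i, D.morseBoundary i = 0 := GraphBraid.OrderedTree.morseBoundary_eq_zero hD hsub
  have hd : ∀ i : ℕ, (D.morseBoundary i).comp (D.morseBoundary (i + 1)) = 0 := fun i => by
    rw [h0, LinearMap.zero_comp]
  exact ⟨D, D.rewritingStabilizes, hd, GraphBraid.OrderedTree.exists_homology_iso hd h0⟩
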